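/- Let $\kappa>1$ and let $(n_m)$, $(d_m)$ be sequences of natural numbers with $d_m\to\infty$ and $n_m/d_m\to\kappa$. For each $m$ (we write $n=n_m$, $d=d_m$) let $\Sigma\in\mathbb R^{d\times d}$ be an invertible covariance matrix (symmetric positive definite) and $\Sigma_{\mathbf z}\in\mathbb R^{d\times d}$ a covariance matrix (symmetric positive semidefinite) that commutes with $\Sigma$; both may depend on $m$. For $W\in\mathbb R^{d\times d}$ put $$\mathcal E(W)=\mathbb E_{z\sim\mathcal N(0,\Sigma_{\mathbf z})}\,\mathbb E_{x\sim\mathcal N(0,\Sigma)}\,\|W^{T}(x+z)-x\|_2^2,\qquad \mathcal E_{\mathrm{Wiener}}=\inf_{W\in\mathbb R^{d\times d}}\mathcal E(W).$$ Let $X,Z\in\mathbb R^{n\times d}$ be random matrices whose $2n$ rows are jointly independent, the rows of $X$ with law $\mathcal N(0,\Sigma)$ and the rows of $Z$ with law $\mathcal N(0,\Sigma_{\mathbf z})$, and let $W_{\mathrm{lsq}}$ be almost surely a minimizer of $W\mapsto\|(X+Z)W-X\|_F^2$ over $\mathbb R^{d\times d}$. Then: 1. for every $m$, $\mathcal E_{\mathrm{Wiener}}$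 is a minimum, attained by the Wiener filter $(\Sigma+\Sigma_{\mathbf z})^{-1}\Sigma$; 2. $\mathcal E(W_{\mathrm{lsq}})$ is asymptotically equal to $\frac{\kappa}{\kappa-1}\mathcal E_{\mathrm{Wiener}}$: for every $\varepsilon>0$, $$\mathbb P\Bigl(\bigl|\mathcal E(W_{\mathrm{lsq}})-\tfrac{\kappa}{\kappa-1}\mathcal E_{\mathrm{Wiener}}\bigr|>\varepsilon\,\tfrac{\kappa}{\kappa-1}\mathcal E_{\mathrm{Wiener}}\Bigr)\to0\quad(m\to\infty);$$ in particular, if $\Sigma_{\mathbf z}\ne0$ for all large $m$, then $\mathcal E(W_{\mathrm{lsq}})\big/\bigl(\tfrac{\kappa}{\kappa-1}\mathcal E_{\mathrm{Wiener}}\bigr)\to1$ in probability; 3. the Wiener error is recovered as $\kappa\to\infty$: $\frac{\kappa}{\kappa-1}\to1$ as $\kappa\to\infty$, and for every $\varepsilon>0$, if $\kappa>1+\frac1\varepsilon$, then $\mathbb P\bigl(|\mathcal E(W_{\mathrm{lsq}})-\mathcal E_{\mathrm{Wiener}}|>\varepsilon\,\mathcal E_{\mathrm{Wiener}}\bigr)\to0$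 as $m\to\infty$; 4. $\mathcal E(W_{\mathrm{lsq}})\ge\mathcal E_{\mathrm{Wiener}}$ for every $m$. -/

import Mathlib

open MeasureTheory ProbabilityTheory Filter Topology

namespace LinearDenoising

/-- Training data: `n` clean rows `X i ~ N(0, Sig)` and `n` noise rows `Z i ~ N(0, Sig1)` in `ℝᵈ`,
all `2 n` of them jointly independent. -/
structure IsTrainingSample {Ω : Type*} [MeasurableSpace Ω] (P : Measure Ω) {n d : ℕ}
    (Sig Sig1 : Matrix (Fin d) (Fin d) ℝ) (X Z : Fin n → Ω → EuclideanSpace ℝ (Fin d)) :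
    Prop where
  law_data : ∀ i, HasLaw (X i) (multivariateGaussian 0 Sig) P
  law_noise : ∀ i, HasLaw (Z i) (multivariateGaussian 0 Sig1) P
  indep : iIndepFun (Sum.elim X Z) P

/-- The `n × d` matrix whose `i`-th row is `v i`. -/
def rowMatrix {n d : ℕ} (v : Fin n → EuclideanSpace ℝ (Fin d)) : Matrix (Fin n) (Fin d) ℝ :=
  Matrix.of fun i j => v i j

/-- The squared Frobenius norm. -/
def frobeniusSq {n d : ℕ} (A : Matrix (Fin n) (Fin d) ℝ) : ℝ :=
  ∑ i, ∑ j, A i j ^ 2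

/-- `W` belongs to `argmin_W ‖Xhat W - X‖_F²`. -/
def IsLeastSquares {n d : ℕ} (Xhat X : Matrix (Fin n) (Fin d) ℝ)
    (W : Matrix (Fin d) (Fin d) ℝ) : Prop :=
  ∀ W' : Matrix (Fin d) (Fin d) ℝ, frobeniusSq (Xhat * W - X) ≤ frobeniusSq (Xhat * W' - X)

/-- The generalization error `E_{z ~ N(0, Sigz)} E_{x ~ N(0, Sig)} ‖Wᵀ (x + z) - x‖²`. -/
noncomputable def genError {d : ℕ} (Sig Sigz W : Matrix (Fin d) (Fin d) ℝ) : ℝ :=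
  ∫ z, ∫ x, ‖Matrix.toEuclideanCLM (𝕜 := ℝ) W.transpose (x + z) - x‖ ^ 2
    ∂(multivariateGaussian 0 Sig) ∂(multivariateGaussian 0 Sigz)

/-- The Wiener filter `(Sig + Sigz)⁻¹ Sig`. -/
noncomputable def wienerFilter {d : ℕ} (Sig Sigz : Matrix (Fin d) (Fin d) ℝ) :
    Matrix (Fin d) (Fin d) ℝ :=
  (Sig + Sigz)⁻¹ * Sig

/-- The generalization error minimized over all linear denoisers. -/
noncomputable def wienerError {d : ℕ} (Sig Sigz : Matrix (Fin d) (Fin d) ℝ) : ℝ :=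
  ⨅ W : Matrix (Fin d) (Fin d) ℝ, genError Sig Sigz W

/-- `E m / f m → 1` in probability, written without division so that it also has its proper
meaning (`E m = f m` with probability tending to one) when `f m = 0`. -/
def AsymptoticallyEqual {Ω : ℕ → Type*} [∀ m, MeasurableSpace (Ω m)]
    (P : ∀ m, Measure (Ω m)) (E : ∀ m, Ω m → ℝ) (f : ℕ → ℝ) : Prop :=
  ∀ ε : ℝ, 0 < ε →
    Tendsto (fun m => P m {ω | ε * |f m| < |E m ω - f m|}) atTop (𝓝 0)

end LinearDenoising

/-!
The excess error of a denoiser `W` over the Wiener filter is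
`∑ k, ⟨W_k - w_k, (Sig + Sigz) (W_k - w_k)⟩`, where `W_k` and `w_k` are the columns of `W` and of
the Wiener filter (`genError_eq_add`). The `k`-th column of the least squares denoiser is the
ordinary least squares regression of the `k`-th coordinate of the clean data on the noisy data.
The residual of the Wiener prediction is Gaussian and uncorrelated with the noisy data, hence
independent of it, and the sum over `k` of its variances is the Wiener error. After whitening of
the noisy data, the excess of the column is `‖β‖²`, where `β = (Gᵀ G)⁻¹ Gᵀ r` for a standard
Gaussian design `G` of size `n × d` and an independent Gaussian response `r`
(`IsTrainingSample.hasLaw_whitenedPair`, `excess_eq_norm_sq_olsCoeff`).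

For a response of variance one, the first two moments of `‖β‖²` are computed exactly. Given `G`, the
form `⟨β, h⟩` in the direction of a unit vector `h` is Gaussian of variance `‖G (Gᵀ G)⁻¹ h‖²`, which
is the inverse square of the distance from `G h` to the image of `hᗮ` under `G`. Since `G h` is
independent of the restriction of `G` to `hᗮ`, that square distance is a chi-squared variable with
`n - d + 1` degrees of freedom (`lintegral_norm_sq_olsDual`), and its inverse moments follow from
its Laplace transform. Polarization gives the mixed fourth moments of `β`, whence
`E ‖β‖² = d / (n - d - 1)` and `E ‖β‖⁴ = d (d + 2) / ((n - d - 1) (n - d - 3))`. The mean tends to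
`1 / (κ - 1)` and the variance to `0`.

By the triangle inequality over the columns, the mean absolute deviation of the excess from
`d / (n - d - 1)` times the Wiener error is at most a vanishing multiple of the Wiener error
(`IsTrainingSample.exists_genError_ae_eq`), uniformly in the covariances. The columns may be
arbitrarily correlated with each other, and Markov's inequality concludes.
-/

open MeasureTheory ProbabilityTheory Filter Topology

namespace LinearDenoising

open scoped RealInnerProductSpace

/-! ### Projections and moments of standard Gaussian vectors -/

section StdGaussian

variable {E : Type*} [NormedAddCommGroup E] [InnerProductSpace ℝ E] [FiniteDimensional ℝ E]
  [MeasurableSpace E] [BorelSpace E]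

lemma map_inner_stdGaussian (s : E) :
    (stdGaussian E).map (fun x => ⟪s, x⟫) = gaussianReal 0 (‖s‖ ^ 2).toNNReal := by
  have h := IsGaussian.map_eq_gaussianReal (μ := stdGaussian E) (innerSL ℝ s)
  rw [variance_dual_stdGaussian, integral_strongDual_stdGaussian, innerSL_apply_norm] at h
  exact h

lemma integral_pow_four_gaussianReal_zero_one : ∫ x, x ^ 4 ∂(gaussianReal 0 1) = 3 := by
  rw [integral_gaussianReal_eq_integral_smul one_ne_zero]
  have h := integral_comp_abs (f := fun x : ℝ => gaussianPDFReal 0 1 x • x ^ 4)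
  have e : ∀ x : ℝ, gaussianPDFReal 0 1 |x| • |x| ^ 4 = gaussianPDFReal 0 1 x • x ^ 4 := by
    intro x
    simp [gaussianPDFReal, Even.pow_abs (show Even 4 by decide)]
  simp_rw [e] at h
  rw [h]
  have h2 := integral_rpow_mul_exp_neg_mul_rpow (p := 2) (q := 4) (b := 1 / 2) (by norm_num)
    (by norm_num) (by norm_num)
  have e2 : ∀ x : ℝ, gaussianPDFReal 0 1 x • x ^ 4
      = (√(2 * Real.pi))⁻¹ * (x ^ (4 : ℝ) * Real.exp (-(1 / 2) * x ^ (2 : ℝ))) := by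
    intro x
    have h4 : x ^ (4 : ℝ) = x ^ 4 := by exact_mod_cast Real.rpow_natCast x 4
    have h2 : x ^ (2 : ℝ) = x ^ 2 := by exact_mod_cast Real.rpow_natCast x 2
    rw [h4, h2]
    simp only [gaussianPDFReal, sub_zero, NNReal.coe_one, mul_one, smul_eq_mul]
    rw [show -x ^ 2 / 2 = -(1 / 2) * x ^ 2 by ring]
    ring
  simp_rw [e2]
  rw [integral_const_mul, h2]
  have g : Real.Gamma ((4 + 1) / 2) = 3 / 4 * √Real.pi := by
    rw [show ((4 : ℝ) + 1) / 2 = 1 / 2 + 1 + 1 by norm_num, Real.Gamma_add_one (by norm_num),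
      Real.Gamma_add_one (by norm_num), Real.Gamma_one_half_eq]
    ring
  have p : (1 / 2 : ℝ) ^ (-((4 : ℝ) + 1) / 2) = 4 * √2 := by
    rw [show -((4 : ℝ) + 1) / 2 = -(2 + 1 / 2) by norm_num, one_div, Real.inv_rpow (by norm_num),
      Real.rpow_neg (by norm_num), inv_inv, Real.rpow_add (by norm_num), Real.sqrt_eq_rpow]
    norm_num
  rw [g, p, Real.sqrt_mul (by norm_num)]
  have : √Real.pi ≠ 0 := by positivity
  field_simp
lemma integral_pow_four_gaussianReal_zero (v : NNReal) :
    ∫ x, x ^ 4 ∂(gaussianReal 0 v) = 3 * (v : ℝ) ^ 2 := by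
  have h := gaussianReal_map_const_mul (μ := 0) (v := 1) (√(v : ℝ))
  have e : NNReal.mk (√(v : ℝ) ^ 2) (sq_nonneg _) * 1 = v := by
    ext; simp
  rw [e, mul_zero] at h
  rw [← h, integral_map (by fun_prop) (by fun_prop)]
  simp_rw [mul_pow]
  rw [integral_const_mul, integral_pow_four_gaussianReal_zero_one,
    show √(v : ℝ) ^ 4 = (√(v : ℝ) ^ 2) ^ 2 by ring, Real.sq_sqrt v.coe_nonneg]
  ring

lemma lintegral_inner_sq_stdGaussian (s : E) :
    ∫⁻ x, ENNReal.ofReal (⟪x, s⟫ ^ 2) ∂(stdGaussian E) = ENNReal.ofReal (‖s‖ ^ 2) := by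
  have h : ∫⁻ x, ENNReal.ofReal (⟪x, s⟫ ^ 2) ∂(stdGaussian E)
      = ∫⁻ y, ENNReal.ofReal (y ^ 2) ∂((stdGaussian E).map (fun x => ⟪s, x⟫)) := by
    rw [lintegral_map (by fun_prop) (by fun_prop)]
    simp_rw [real_inner_comm]
  have hi : ∀ v : NNReal, Integrable (fun x : ℝ => x ^ 2) (gaussianReal 0 v) :=
    fun v => (memLp_id_gaussianReal 2).integrable_sq
  rw [h, map_inner_stdGaussian, ← ofReal_integral_eq_lintegral_ofReal
    (hi _) (ae_of_all _ fun x => sq_nonneg _)]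
  have hv := variance_fun_id_gaussianReal (μ := 0) (v := (‖s‖ ^ 2).toNNReal)
  rw [variance_of_integral_eq_zero (by fun_prop) (by simp)] at hv
  rw [hv, Real.coe_toNNReal _ (by positivity)]

lemma lintegral_inner_pow_four_stdGaussian (s : E) :
    ∫⁻ x, ENNReal.ofReal (⟪x, s⟫ ^ 4) ∂(stdGaussian E) = ENNReal.ofReal (3 * ‖s‖ ^ 4) := by
  have h : ∫⁻ x, ENNReal.ofReal (⟪x, s⟫ ^ 4) ∂(stdGaussian E)
      = ∫⁻ y, ENNReal.ofReal (y ^ 4) ∂((stdGaussian E).map (fun x => ⟪s, x⟫)) := by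
    rw [lintegral_map (by fun_prop) (by fun_prop)]
    simp_rw [real_inner_comm]
  have hi : ∀ v : NNReal, Integrable (fun x : ℝ => x ^ 4) (gaussianReal 0 v) := by
    intro v
    have := (memLp_id_gaussianReal (μ := 0) (v := v) 4).integrable_norm_pow (by norm_num)
    refine this.congr (ae_of_all _ fun x => ?_)
    simp [Even.pow_abs (show Even 4 by decide)]
  rw [h, map_inner_stdGaussian, ← ofReal_integral_eq_lintegral_ofReal (hi _)
    (ae_of_all _ fun x => by positivity), integral_pow_four_gaussianReal_zero,
    Real.coe_toNNReal _ (by positivity)]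
  ring_nf

/-- The orthogonal projection of a standard Gaussian vector is a standard Gaussian vector of the
subspace. -/
lemma map_orthogonalProjection_stdGaussian (V : Submodule ℝ E) :
    (stdGaussian E).map V.orthogonalProjectionOnto = stdGaussian V := by
  apply Measure.ext_of_charFun
  ext t
  rw [charFun_stdGaussian, charFun_apply, integral_map (by fun_prop) (by fun_prop)]
  have : ∀ x : E, ⟪V.orthogonalProjectionOnto x, t⟫ = ⟪x, (t : E)⟫ := fun x => by
    rw [Submodule.inner_orthogonalProjectionOnto_eq_of_mem_right]
  simp_rw [this]
  rw [← charFun_apply, charFun_stdGaussian]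
  simp

/-- A standard Gaussian vector is the sum of independent standard Gaussian vectors of a line and of
its orthogonal complement. -/
lemma map_smul_add_stdGaussian {h : E} (hh : ‖h‖ = 1) :
    ((stdGaussian (ℝ ∙ h)ᗮ).prod (gaussianReal 0 1)).map (fun p => p.2 • h + (p.1 : E))
      = stdGaussian E := by
  apply Measure.ext_of_charFun
  ext t
  rw [charFun_stdGaussian, charFun_apply, integral_map (by fun_prop) (by fun_prop)]
  have e : ∀ p : (ℝ ∙ h)ᗮ × ℝ, Complex.exp (⟪p.2 • h + (p.1 : E), t⟫ * Complex.I)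
      = Complex.exp (⟪p.1, (ℝ ∙ h)ᗮ.orthogonalProjectionOnto t⟫ * Complex.I)
        * Complex.exp (⟪p.2, ⟪h, t⟫⟫ * Complex.I) := by
    intro p
    rw [← Complex.exp_add, ← add_mul, ← Complex.ofReal_add, inner_add_left, real_inner_smul_left,
      Submodule.inner_orthogonalProjectionOnto_eq_of_mem_left]
    simp [mul_comm, add_comm]
  simp_rw [e]
  rw [integral_prod_mul
    (fun w : (ℝ ∙ h)ᗮ => Complex.exp (⟪w, (ℝ ∙ h)ᗮ.orthogonalProjectionOnto t⟫ * Complex.I))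
    (fun a : ℝ => Complex.exp (⟪a, ⟪h, t⟫⟫ * Complex.I)),
    ← charFun_apply, ← charFun_apply, charFun_stdGaussian, charFun_gaussianReal, ← Complex.exp_add]
  have hn : ‖t‖ ^ 2 = ⟪h, t⟫ ^ 2 + ‖(ℝ ∙ h)ᗮ.orthogonalProjectionOnto t‖ ^ 2 := by
    rw [Submodule.norm_sq_eq_add_norm_sq_projection t (ℝ ∙ h)]
    congr 1
    have := Submodule.starProjection_unit_singleton ℝ hh t
    rw [← Submodule.norm_coe, ← Submodule.starProjection_apply, this, norm_smul, hh]
    simp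
  congr 1
  rw [show ((‖t‖ : ℂ)) ^ 2 = ((‖t‖ ^ 2 : ℝ) : ℂ) by push_cast; rfl, hn]
  push_cast
  simp
  ring

/-- A standard Gaussian vector avoids every proper subspace almost surely. -/
lemma ae_notMem_stdGaussian {S : Submodule ℝ E} (hS : S ≠ ⊤) : ∀ᵐ x ∂(stdGaussian E), x ∉ S := by
  obtain ⟨u, hu, hu0⟩ : ∃ u ∈ Sᗮ, u ≠ 0 := by
    rw [← Submodule.ne_bot_iff]
    rwa [Ne, Submodule.orthogonal_eq_bot_iff]
  have hv : (‖u‖ ^ 2).toNNReal ≠ 0 := by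
    have : 0 < ‖u‖ ^ 2 := by positivity
    simpa using hu0
  have := nullSingletonClass_gaussianReal (μ := 0) hv
  have h0 : ∀ᵐ y ∂((stdGaussian E).map (fun x => ⟪u, x⟫)), y ≠ 0 := by
    rw [map_inner_stdGaussian, ae_iff]
    simp
  filter_upwards [ae_of_ae_map (by fun_prop) h0] with x hx hxS
  exact hx (by rw [real_inner_comm]; exact hu x hxS)

end StdGaussian

/-! ### Inverse moments of chi-squared variables -/

section Laplace

variable {V : Type*} [NormedAddCommGroup V] [InnerProductSpace ℝ V] [FiniteDimensional ℝ V]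
  [MeasurableSpace V] [BorelSpace V]

lemma integral_exp_neg_mul_sq_gaussianReal {t : ℝ} (ht : 0 ≤ t) :
    ∫ x, Real.exp (-t * x ^ 2) ∂(gaussianReal 0 1) = (1 + 2 * t) ^ (-(1 / 2) : ℝ) := by
  rw [integral_gaussianReal_eq_integral_smul one_ne_zero]
  have e : ∀ x : ℝ, gaussianPDFReal 0 1 x • Real.exp (-t * x ^ 2)
      = (√(2 * Real.pi))⁻¹ * Real.exp (-(t + 1 / 2) * x ^ 2) := by
    intro x
    simp only [gaussianPDFReal, sub_zero, NNReal.coe_one, mul_one, smul_eq_mul]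
    rw [mul_assoc, ← Real.exp_add]
    ring_nf
  simp_rw [e]
  rw [integral_const_mul, integral_gaussian, ← Real.sqrt_inv, ← Real.sqrt_mul (by positivity),
    Real.rpow_neg (by positivity), ← Real.sqrt_eq_rpow, ← Real.sqrt_inv]
  congr 1
  field_simp
  ring

/-- The Laplace transform of the chi-squared law. -/
lemma integral_exp_neg_mul_norm_sq_stdGaussian {t : ℝ} (ht : 0 ≤ t) :
    ∫ x, Real.exp (-t * ‖x‖ ^ 2) ∂(stdGaussian V)
      = (1 + 2 * t) ^ (-(Module.finrank ℝ V / 2) : ℝ) := by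
  rw [stdGaussian, integral_map (Measurable.aemeasurable (by fun_prop)) (by fun_prop)]
  have e : ∀ x : Fin (Module.finrank ℝ V) → ℝ,
      Real.exp (-t * ‖∑ i, x i • stdOrthonormalBasis ℝ V i‖ ^ 2)
        = ∏ i, Real.exp (-t * x i ^ 2) := by
    intro x
    rw [← Real.exp_sum, ← Finset.mul_sum, ← real_inner_self_eq_norm_sq,
      (stdOrthonormalBasis ℝ V).orthonormal.inner_sum]
    simp [sq]
  simp_rw [e]
  rw [integral_fintype_prod_eq_prod (f := fun _ x => Real.exp (-t * x ^ 2))]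
  simp_rw [integral_exp_neg_mul_sq_gaussianReal ht]
  rw [Finset.prod_const, Finset.card_univ, Fintype.card_fin, ← Real.rpow_natCast,
    ← Real.rpow_mul (by positivity)]
  congr 1
  ring

lemma lintegral_exp_neg_mul_norm_sq_stdGaussian {t : ℝ} (ht : 0 ≤ t) :
    ∫⁻ x, ENNReal.ofReal (Real.exp (-t * ‖x‖ ^ 2)) ∂(stdGaussian V)
      = ENNReal.ofReal ((1 + 2 * t) ^ (-(Module.finrank ℝ V / 2) : ℝ)) := by
  rw [← integral_exp_neg_mul_norm_sq_stdGaussian ht, ofReal_integral_eq_lintegral_ofReal _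
    (ae_of_all _ fun x => (Real.exp_pos _).le)]
  refine Integrable.of_bound (C := 1) (by fun_prop) (ae_of_all _ fun x => ?_)
  rw [Real.norm_of_nonneg (Real.exp_pos _).le, Real.exp_le_one_iff]
  nlinarith [sq_nonneg ‖x‖]

lemma ae_ne_zero_stdGaussian (hV : 0 < Module.finrank ℝ V) : ∀ᵐ x ∂(stdGaussian V), x ≠ 0 := by
  have : (⊥ : Submodule ℝ V) ≠ ⊤ := by
    intro h
    rw [← finrank_top, ← h, finrank_bot] at hV
    exact lt_irrefl _ hV
  filter_upwards [ae_notMem_stdGaussian this] with x hx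
  simpa using hx

/-- `E ‖x‖⁻² = 1 / (k - 2)` for a standard Gaussian vector in dimension `k > 2`. -/
lemma lintegral_norm_sq_inv_stdGaussian (hV : 2 < Module.finrank ℝ V) :
    ∫⁻ x, ENNReal.ofReal ((‖x‖ ^ 2)⁻¹) ∂(stdGaussian V)
      = ENNReal.ofReal (1 / ((Module.finrank ℝ V : ℝ) - 2)) := by
  obtain ⟨k, hk⟩ : ∃ k : ℝ, k = (Module.finrank ℝ V : ℝ) := ⟨_, rfl⟩
  rw [← hk]
  have hk2 : 2 < k := by rw [hk]; exact_mod_cast hV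
  have h1 : ∀ᵐ x ∂(stdGaussian V), ENNReal.ofReal ((‖x‖ ^ 2)⁻¹)
      = ∫⁻ t in Set.Ioi (0 : ℝ), ENNReal.ofReal (Real.exp (-t * ‖x‖ ^ 2)) := by
    filter_upwards [ae_ne_zero_stdGaussian (V := V) (by omega)] with x hx
    have hx : 0 < ‖x‖ ^ 2 := by positivity
    have e : ∀ t : ℝ, Real.exp (-t * ‖x‖ ^ 2) = Real.exp (-‖x‖ ^ 2 * t) := fun t => by ring_nf
    simp_rw [e]
    rw [← ofReal_integral_eq_lintegral_ofReal (integrableOn_exp_mul_Ioi (by linarith) 0)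
      (ae_of_all _ fun t => (Real.exp_pos _).le), integral_exp_mul_Ioi (by linarith)]
    congr 1
    simp [neg_div_neg_eq]
  rw [lintegral_congr_ae h1, lintegral_lintegral_swap (by fun_prop)]
  rw [setLIntegral_congr_fun measurableSet_Ioi
    (fun t ht => lintegral_exp_neg_mul_norm_sq_stdGaussian (le_of_lt ht)), ← hk]
  have hd : ∀ t ∈ Set.Ici (0 : ℝ), HasDerivAt
      (fun t : ℝ => -(1 / (k - 2)) * (1 + 2 * t) ^ (1 - k / 2)) ((1 + 2 * t) ^ (-(k / 2))) t := by
    intro t ht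
    have ht : 0 < 1 + 2 * t := by have : 0 ≤ t := ht; linarith
    have h := ((((hasDerivAt_id t).const_mul 2).const_add 1).rpow_const (p := 1 - k / 2)
      (Or.inl ht.ne')).const_mul (-(1 / (k - 2)))
    refine h.congr_deriv ?_
    simp only [id]
    have : k - 2 ≠ 0 := by linarith
    rw [show 1 - k / 2 - 1 = -(k / 2) by ring]
    field_simp
    ring
  have hlim : Tendsto (fun t : ℝ => -(1 / (k - 2)) * (1 + 2 * t) ^ (1 - k / 2)) atTop (𝓝 0) := by
    rw [← mul_zero (-(1 / (k - 2)))]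
    refine Tendsto.const_mul _ ?_
    rw [show 1 - k / 2 = -(k / 2 - 1) by ring]
    refine (tendsto_rpow_neg_atTop (by linarith)).comp ?_
    exact tendsto_atTop_add_const_left _ _ (tendsto_id.const_mul_atTop (by norm_num))
  have hpos : ∀ t ∈ Set.Ioi (0 : ℝ), 0 ≤ (1 + 2 * t) ^ (-(k / 2)) := by
    intro t ht
    have : 0 < t := ht
    positivity
  rw [← ofReal_integral_eq_lintegral_ofReal
    (integrableOn_Ioi_deriv_of_nonneg' hd hpos hlim)
    ((ae_restrict_iff' measurableSet_Ioi).2 (ae_of_all _ hpos)),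
    integral_Ioi_of_hasDerivAt_of_nonneg' hd hpos hlim]
  simp

/-- `E ‖x‖⁻⁴ = 1 / ((k - 2) (k - 4))` for a standard Gaussian vector in dimension `k > 4`. -/
lemma lintegral_norm_pow_four_inv_stdGaussian (hV : 4 < Module.finrank ℝ V) :
    ∫⁻ x, ENNReal.ofReal ((‖x‖ ^ 4)⁻¹) ∂(stdGaussian V)
      = ENNReal.ofReal
        (1 / (((Module.finrank ℝ V : ℝ) - 2) * ((Module.finrank ℝ V : ℝ) - 4))) := by
  obtain ⟨k, hk⟩ : ∃ k : ℝ, k = (Module.finrank ℝ V : ℝ) := ⟨_, rfl⟩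
  rw [← hk]
  have hk4 : 4 < k := by rw [hk]; exact_mod_cast hV
  have h1 : ∀ᵐ x ∂(stdGaussian V), ENNReal.ofReal ((‖x‖ ^ 4)⁻¹)
      = ∫⁻ t in Set.Ioi (0 : ℝ), ENNReal.ofReal (t * Real.exp (-t * ‖x‖ ^ 2)) := by
    filter_upwards [ae_ne_zero_stdGaussian (V := V) (by omega)] with x hx
    have hx : 0 < ‖x‖ ^ 2 := by positivity
    have h := Real.integral_rpow_mul_exp_neg_mul_Ioi (a := 2) (by norm_num) hx
    have e : ∀ t : ℝ, t ^ ((2 : ℝ) - 1) * Real.exp (-(‖x‖ ^ 2 * t))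
        = t * Real.exp (-t * ‖x‖ ^ 2) := fun t => by
      rw [show (2 : ℝ) - 1 = 1 by norm_num, Real.rpow_one]; ring_nf
    simp_rw [e] at h
    have hG : Real.Gamma 2 = 1 := by
      simp
    rw [hG, mul_one, show (2 : ℝ) = (2 : ℕ) by norm_num, Real.rpow_natCast] at h
    rw [← ofReal_integral_eq_lintegral_ofReal
      (Integrable.of_integral_ne_zero (by rw [h]; positivity))
      ((ae_restrict_iff' measurableSet_Ioi).2 (ae_of_all _ fun t ht => ?_)), h]
    · congr 1
      field_simp
    · have : 0 < t := ht
      positivity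
  rw [lintegral_congr_ae h1, lintegral_lintegral_swap (by fun_prop)]
  have h2 : ∀ t ∈ Set.Ioi (0 : ℝ),
      ∫⁻ x, ENNReal.ofReal (t * Real.exp (-t * ‖x‖ ^ 2)) ∂(stdGaussian V)
        = ENNReal.ofReal (t * (1 + 2 * t) ^ (-(k / 2))) := by
    intro t ht
    have ht : 0 ≤ t := le_of_lt ht
    simp_rw [ENNReal.ofReal_mul ht]
    rw [lintegral_const_mul _ (by fun_prop), lintegral_exp_neg_mul_norm_sq_stdGaussian ht, ← hk]
  rw [setLIntegral_congr_fun measurableSet_Ioi h2]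
  -- the primitive comes from writing `t = ((1 + 2 t) - 1) / 2`
  have hd : ∀ t ∈ Set.Ici (0 : ℝ), HasDerivAt
      (fun t : ℝ => 1 / 2 * (-(1 / (k - 4)) * (1 + 2 * t) ^ (2 - k / 2)
        + 1 / (k - 2) * (1 + 2 * t) ^ (1 - k / 2))) (t * (1 + 2 * t) ^ (-(k / 2))) t := by
    intro t ht
    have ht : 0 < 1 + 2 * t := by have : 0 ≤ t := ht; linarith
    have h := (((((hasDerivAt_id t).const_mul 2).const_add 1).rpow_const (p := 2 - k / 2)
      (Or.inl ht.ne')).const_mul (-(1 / (k - 4)))).add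
      (((((hasDerivAt_id t).const_mul 2).const_add 1).rpow_const (p := 1 - k / 2)
      (Or.inl ht.ne')).const_mul (1 / (k - 2)))
    refine (h.const_mul (1 / 2)).congr_deriv ?_
    simp only [id]
    have h2 : k - 2 ≠ 0 := by linarith
    have h4 : k - 4 ≠ 0 := by linarith
    rw [show 2 - k / 2 - 1 = -(k / 2) + 1 by ring, show 1 - k / 2 - 1 = -(k / 2) by ring,
      Real.rpow_add ht, Real.rpow_one]
    field_simp
    ring
  have hlim : Tendsto (fun t : ℝ => 1 / 2 * (-(1 / (k - 4)) * (1 + 2 * t) ^ (2 - k / 2)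
        + 1 / (k - 2) * (1 + 2 * t) ^ (1 - k / 2))) atTop (𝓝 0) := by
    have hl : Tendsto (fun t : ℝ => 1 + 2 * t) atTop atTop :=
      tendsto_atTop_add_const_left _ _ (tendsto_id.const_mul_atTop (by norm_num))
    have t1 := ((tendsto_rpow_neg_atTop (y := k / 2 - 2) (by linarith)).comp hl).const_mul
      (-(1 / (k - 4)))
    have t2 := ((tendsto_rpow_neg_atTop (y := k / 2 - 1) (by linarith)).comp hl).const_mul
      (1 / (k - 2))
    have t3 := (t1.add t2).const_mul (1 / 2)
    simp only [Function.comp_def, neg_sub, mul_zero, add_zero] at t3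
    exact t3
  have hpos : ∀ t ∈ Set.Ioi (0 : ℝ), 0 ≤ t * (1 + 2 * t) ^ (-(k / 2)) := by
    intro t ht
    have : 0 < t := ht
    positivity
  rw [← ofReal_integral_eq_lintegral_ofReal
    (integrableOn_Ioi_deriv_of_nonneg' hd hpos hlim)
    ((ae_restrict_iff' measurableSet_Ioi).2 (ae_of_all _ hpos)),
    integral_Ioi_of_hasDerivAt_of_nonneg' hd hpos hlim]
  congr 1
  have h2 : k - 2 ≠ 0 := by linarith
  have h4 : k - 4 ≠ 0 := by linarith
  simp
  field_simp
  ring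

end Laplace

/-! ### Standard Gaussian designs have full rank -/

section FullRank

variable {E : Type*} [NormedAddCommGroup E] [InnerProductSpace ℝ E] [FiniteDimensional ℝ E]
  [MeasurableSpace E] [BorelSpace E]

/-- At most `dim E` independent standard Gaussian vectors are almost surely linearly independent. -/
lemma ae_linearIndependent_pi_stdGaussian {n : ℕ} (hn : n ≤ Module.finrank ℝ E) :
    ∀ᵐ g ∂(Measure.pi fun _ : Fin n => stdGaussian E), LinearIndependent ℝ g := by
  induction n with
  | zero => exact ae_of_all _ fun g => linearIndependent_empty_type
  | succ n ih =>
    have hopen : IsOpen {g : Fin (n + 1) → E | LinearIndependent ℝ g} :=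
      isOpen_setOfPred_linearIndependent
    have hm : MeasurableSet {p : (Fin n → E) × E |
        LinearIndependent ℝ (Fin.cons p.2 p.1 : Fin (n + 1) → E)} := by
      refine hopen.measurableSet.preimage (measurable_pi_iff.2 fun i => ?_)
      refine Fin.cases ?_ (fun i => ?_) i <;> simp <;> fun_prop
    have hcons : ∀ᵐ p ∂((Measure.pi fun _ : Fin n => stdGaussian E).prod (stdGaussian E)),
        LinearIndependent ℝ (Fin.cons p.2 p.1 : Fin (n + 1) → E) := by
      rw [Measure.ae_prod_iff_ae_ae hm]
      filter_upwards [ih (by omega)] with v hv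
      have hS : Submodule.span ℝ (Set.range v) ≠ ⊤ := by
        intro h
        have := finrank_range_le_card (R := ℝ) v
        rw [Set.finrank, h, finrank_top, Fintype.card_fin] at this
        omega
      filter_upwards [ae_notMem_stdGaussian hS] with x hx
      exact linearIndependent_finCons.2 ⟨hv, hx⟩
    have hswap := (Measure.measurePreserving_swap (μ := stdGaussian E)
      (ν := Measure.pi fun _ : Fin n => stdGaussian E)).quasiMeasurePreserving.ae hcons
    filter_upwards [(measurePreserving_piFinSuccAbove
      (fun _ : Fin (n + 1) => stdGaussian E) 0).quasiMeasurePreserving.ae hswap] with g hg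
    convert hg using 1
    ext i
    refine Fin.cases ?_ (fun i => ?_) i <;> simp [MeasurableEquiv.piFinSuccAbove, Fin.tail]

/-- At least `dim E` independent standard Gaussian vectors almost surely span. -/
lemma ae_span_eq_top_pi_stdGaussian {n : ℕ} (hn : Module.finrank ℝ E ≤ n) :
    ∀ᵐ g ∂(Measure.pi fun _ : Fin n => stdGaussian E),
      Submodule.span ℝ (Set.range g) = ⊤ := by
  induction n, hn using Nat.le_induction with
  | base =>
    filter_upwards [ae_linearIndependent_pi_stdGaussian (E := E) le_rfl] with g hg
    exact hg.span_eq_top_of_card_eq_finrank' (by simp)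
  | succ n hn ih =>
    have h1 := (measurePreserving_piFinSuccAbove
      (fun _ : Fin (n + 1) => stdGaussian E) 0).quasiMeasurePreserving.ae
      (Measure.quasiMeasurePreserving_snd.ae ih)
    filter_upwards [h1] with g hg
    rw [eq_top_iff, ← hg]
    refine Submodule.span_mono ?_
    rintro _ ⟨i, rfl⟩
    exact ⟨_, rfl⟩

end FullRank

/-! ### The geometry of ordinary least squares -/

section OrdinaryLeastSquares

variable {n d : ℕ}

/-- The ordinary least squares coefficients `(Gᵀ G)⁻¹ Gᵀ r` of the response `r`, the rows of the
design matrix `G` being the vectors `g i`. It is `0` when `Gᵀ G` is singular, which has probability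
zero for a standard Gaussian design with at least `d` rows. -/
noncomputable def olsCoeff (g : Fin n → EuclideanSpace ℝ (Fin d)) (r : EuclideanSpace ℝ (Fin n)) :
    EuclideanSpace ℝ (Fin d) :=
  WithLp.toLp 2 (((rowMatrix g).transpose * rowMatrix g)⁻¹.mulVec
    ((rowMatrix g).transpose.mulVec r.ofLp))

/-- The vector `G (Gᵀ G)⁻¹ h`, which represents the linear form `r ↦ ⟪olsCoeff g r, h⟫`. -/
noncomputable def olsDual (g : Fin n → EuclideanSpace ℝ (Fin d)) (h : EuclideanSpace ℝ (Fin d)) :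
    EuclideanSpace ℝ (Fin n) :=
  WithLp.toLp 2 ((rowMatrix g).mulVec
    (((rowMatrix g).transpose * rowMatrix g)⁻¹.mulVec h.ofLp))

lemma inner_olsCoeff (g : Fin n → EuclideanSpace ℝ (Fin d)) (r : EuclideanSpace ℝ (Fin n))
    (h : EuclideanSpace ℝ (Fin d)) : ⟪olsCoeff g r, h⟫ = ⟪r, olsDual g h⟫ := by
  simp only [olsCoeff, olsDual, EuclideanSpace.inner_eq_star_dotProduct, star_trivial]
  set G := rowMatrix g
  have hs : ((G.transpose * G)⁻¹).transpose = (G.transpose * G)⁻¹ := by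
    rw [Matrix.transpose_nonsing_inv]
    simp
  rw [Matrix.mulVec_mulVec, Matrix.mulVec_mulVec, Matrix.dotProduct_mulVec,
    ← Matrix.mulVec_transpose, Matrix.transpose_mul, Matrix.transpose_transpose, hs,
    dotProduct_comm]

lemma rowMatrix_mulVec (g : Fin n → EuclideanSpace ℝ (Fin d)) (v : EuclideanSpace ℝ (Fin d))
    (i : Fin n) : (rowMatrix g).mulVec v.ofLp i = ⟪g i, v⟫ := by
  simp [rowMatrix, Matrix.mulVec, dotProduct, PiLp.inner_apply, mul_comm]

lemma inner_toLp_rowMatrix_mulVec (g : Fin n → EuclideanSpace ℝ (Fin d))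
    (s : EuclideanSpace ℝ (Fin n)) (v : Fin d → ℝ) :
    ⟪s, WithLp.toLp 2 ((rowMatrix g).mulVec v)⟫
      = ⟪(WithLp.toLp 2 ((rowMatrix g).transpose.mulVec s.ofLp) : EuclideanSpace ℝ (Fin d)),
        WithLp.toLp 2 v⟫ := by
  simp only [EuclideanSpace.inner_eq_star_dotProduct, star_trivial]
  rw [dotProduct_comm, Matrix.dotProduct_mulVec, ← Matrix.mulVec_transpose, dotProduct_comm]

lemma isUnit_gram_of_span_eq_top {g : Fin n → EuclideanSpace ℝ (Fin d)}
    (hg : Submodule.span ℝ (Set.range g) = ⊤) :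
    IsUnit ((rowMatrix g).transpose * rowMatrix g).det := by
  have hinj : Function.Injective (rowMatrix g).mulVec := by
    rw [← Matrix.coe_mulVecLin, ← LinearMap.ker_eq_bot, LinearMap.ker_eq_bot']
    intro v hv
    have hv0 : ∀ i, ⟪g i, (WithLp.toLp 2 v : EuclideanSpace ℝ (Fin d))⟫ = 0 := fun i => by
      rw [← rowMatrix_mulVec]
      exact congrFun hv i
    have hmem : (WithLp.toLp 2 v : EuclideanSpace ℝ (Fin d))
        ∈ (Submodule.span ℝ (Set.range g))ᗮ := by
      rw [Submodule.mem_orthogonal]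
      intro u hu
      induction hu using Submodule.span_induction with
      | mem x hx => obtain ⟨i, rfl⟩ := hx; exact hv0 i
      | zero => simp
      | add x y _ _ hx hy => rw [inner_add_left, hx, hy, add_zero]
      | smul a x _ hx => rw [real_inner_smul_left, hx, mul_zero]
    rw [hg, Submodule.top_orthogonal_eq_bot, Submodule.mem_bot] at hmem
    simpa using congrArg WithLp.ofLp hmem
  have := Matrix.PosDef.conjTranspose_mul_self (rowMatrix g) hinj
  rw [Matrix.conjTranspose_eq_transpose_of_trivial] at this
  exact this.det_pos.ne'.isUnit

lemma transpose_mulVec_olsDual {g : Fin n → EuclideanSpace ℝ (Fin d)}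
    (hg : Submodule.span ℝ (Set.range g) = ⊤) (h : EuclideanSpace ℝ (Fin d)) :
    (rowMatrix g).transpose.mulVec (olsDual g h).ofLp = h.ofLp := by
  rw [olsDual, Matrix.mulVec_mulVec, Matrix.mulVec_mulVec,
    Matrix.mul_nonsing_inv _ (isUnit_gram_of_span_eq_top hg), Matrix.one_mulVec]

/-- The linear map `v ↦ (⟪w i, v⟫)ᵢ` with the vectors `w i` as rows. -/
noncomputable def rowMap {F : Type*} [NormedAddCommGroup F] [InnerProductSpace ℝ F]
    (w : Fin n → F) : F →ₗ[ℝ] EuclideanSpace ℝ (Fin n) where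
  toFun v := WithLp.toLp 2 fun i => ⟪w i, v⟫
  map_add' u v := by ext i; simp [inner_add_right]
  map_smul' a v := by ext i; simp [real_inner_smul_right]

section Split

variable {h : EuclideanSpace ℝ (Fin d)} {w : Fin n → (ℝ ∙ h)ᗮ} {c : EuclideanSpace ℝ (Fin n)}

/-- A full rank design is injective on the hyperplane `hᗮ`, whose image has therefore
codimension `n - d + 1`. -/
lemma finrank_orthogonal_range_rowMap (hh : ‖h‖ = 1)
    (hg : Submodule.span ℝ (Set.range fun i => c i • h + (w i : EuclideanSpace ℝ (Fin d))) = ⊤) :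
    Module.finrank ℝ (LinearMap.range (rowMap w))ᗮ + d = n + 1 := by
  have hinj : Function.Injective (rowMap w) := by
    rw [← LinearMap.ker_eq_bot, LinearMap.ker_eq_bot']
    intro v hv
    have hv0 : ∀ i, ⟪w i, v⟫ = 0 := fun i => congrFun (congrArg WithLp.ofLp hv) i
    have hhv : ⟪h, (v : EuclideanSpace ℝ (Fin d))⟫ = 0 :=
      Submodule.mem_orthogonal_singleton_iff_inner_right.1 v.2
    have hmem : (v : EuclideanSpace ℝ (Fin d)) ∈ (Submodule.span ℝ
        (Set.range fun i => c i • h + (w i : EuclideanSpace ℝ (Fin d))))ᗮ := by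
      rw [Submodule.mem_orthogonal]
      intro u hu
      induction hu using Submodule.span_induction with
      | mem x hx =>
        obtain ⟨i, rfl⟩ := hx
        have := hv0 i
        rw [Submodule.coe_inner] at this
        simp only [inner_add_left, real_inner_smul_left, hhv, this]
        simp
      | zero => simp
      | add x y _ _ hx hy => rw [inner_add_left, hx, hy, add_zero]
      | smul a x _ hx => rw [real_inner_smul_left, hx, mul_zero]
    rw [hg, Submodule.top_orthogonal_eq_bot, Submodule.mem_bot] at hmem
    exact_mod_cast hmem
  have h1 := (LinearMap.range (rowMap w)).finrank_add_finrank_orthogonal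
  rw [LinearMap.finrank_range_of_inj hinj, finrank_euclideanSpace_fin] at h1
  have h2 := (ℝ ∙ h).finrank_add_finrank_orthogonal
  have h0 : h ≠ 0 := by rintro rfl; simp at hh
  rw [finrank_span_singleton h0, finrank_euclideanSpace_fin] at h2
  omega

/-- If `h` is a unit vector and `c = G h`, then `‖G (Gᵀ G)⁻¹ h‖⁻¹` is the distance of `c` to the
image of `hᗮ` under `G`. -/
lemma norm_sq_olsDual (hh : ‖h‖ = 1)
    (hg : Submodule.span ℝ (Set.range fun i => c i • h + (w i : EuclideanSpace ℝ (Fin d))) = ⊤) :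
    ‖olsDual (fun i => c i • h + (w i : EuclideanSpace ℝ (Fin d))) h‖ ^ 2
      = (‖(LinearMap.range (rowMap w))ᗮ.orthogonalProjectionOnto c‖ ^ 2)⁻¹ := by
  set g : Fin n → EuclideanSpace ℝ (Fin d) := fun i => c i • h + (w i : EuclideanSpace ℝ (Fin d))
    with hgdef
  set s := olsDual g h with hs
  have hGs := transpose_mulVec_olsDual hg h
  -- the image under `G` of a vector split along `h`
  have hG : ∀ (a : ℝ) (v : (ℝ ∙ h)ᗮ),
      (WithLp.toLp 2 ((rowMatrix g).mulVec (a • h + (v : EuclideanSpace ℝ (Fin d))).ofLp) :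
        EuclideanSpace ℝ (Fin n)) = a • c + rowMap w v := by
    intro a v
    ext i
    have hhv : ⟪h, (v : EuclideanSpace ℝ (Fin d))⟫ = 0 :=
      Submodule.mem_orthogonal_singleton_iff_inner_right.1 v.2
    have hwh : ⟪(w i : EuclideanSpace ℝ (Fin d)), h⟫ = 0 :=
      Submodule.mem_orthogonal_singleton_iff_inner_left.1 (w i).2
    have : (rowMatrix g).mulVec (a • h + (v : EuclideanSpace ℝ (Fin d))).ofLp i
      = a * c i + ⟪w i, v⟫ := by
      rw [rowMatrix_mulVec, hgdef]
      simp only [inner_add_left, inner_add_right, real_inner_smul_left, real_inner_smul_right,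
        hhv, hwh, real_inner_self_eq_norm_sq, hh, Submodule.coe_inner]
      ring
    simpa [rowMap] using this
  have hsG : ∀ (a : ℝ) (v : (ℝ ∙ h)ᗮ), ⟪s, a • c + rowMap w v⟫ = a := by
    intro a v
    have hhv : ⟪h, (v : EuclideanSpace ℝ (Fin d))⟫ = 0 :=
      Submodule.mem_orthogonal_singleton_iff_inner_right.1 v.2
    rw [← hG, inner_toLp_rowMatrix_mulVec, hGs]
    change ⟪h, a • h + (v : EuclideanSpace ℝ (Fin d))⟫ = a
    rw [inner_add_right, real_inner_smul_right, hhv, real_inner_self_eq_norm_sq, hh]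
    ring
  have hsV : s ∈ (LinearMap.range (rowMap w))ᗮ := by
    rw [Submodule.mem_orthogonal']
    rintro _ ⟨v, rfl⟩
    simpa using hsG 0 v
  have hsc : ⟪s, c⟫ = 1 := by simpa using hsG 1 0
  obtain ⟨a, v, hav⟩ : ∃ (a : ℝ) (v : (ℝ ∙ h)ᗮ), s = a • c + rowMap w v := by
    set b : EuclideanSpace ℝ (Fin d) := WithLp.toLp 2
      (((rowMatrix g).transpose * rowMatrix g)⁻¹.mulVec h.ofLp) with hb
    obtain ⟨y, hy, z, hz, hyz⟩ := (ℝ ∙ h).exists_add_mem_mem_orthogonal b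
    obtain ⟨a, rfl⟩ := Submodule.mem_span_singleton.1 hy
    refine ⟨a, ⟨z, hz⟩, ?_⟩
    rw [← hG, ← hyz]
    rfl
  set p := (LinearMap.range (rowMap w))ᗮ.orthogonalProjectionOnto c with hp
  have hsp : s = a • (p : EuclideanSpace ℝ (Fin n)) := by
    have h1 : ((LinearMap.range (rowMap w))ᗮ.orthogonalProjectionOnto s :
        EuclideanSpace ℝ (Fin n)) = s :=
      congrArg Subtype.val (Submodule.orthogonalProjectionOnto_mem_subspace_eq_self ⟨s, hsV⟩)
    rw [← h1, hav, map_add, map_smul,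
      Submodule.orthogonalProjectionOnto_orthogonal_apply_eq_zero (LinearMap.mem_range_self _ v)]
    simp [hp]
  have hap : a * ‖p‖ ^ 2 = 1 := by
    rw [← hsc, hsp, real_inner_smul_left, ← Submodule.inner_orthogonalProjectionOnto_eq_of_mem_left,
      real_inner_self_eq_norm_sq]
  have hp0 : ‖p‖ ^ 2 ≠ 0 := by
    intro h0
    rw [h0] at hap
    simp at hap
  rw [hsp, norm_smul, mul_pow, Submodule.norm_coe, Real.norm_eq_abs, sq_abs]
  rw [← mul_left_inj' hp0, inv_mul_cancel₀ hp0]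
  linear_combination (a * ‖p‖ ^ 2 + 1) * hap

end Split

end OrdinaryLeastSquares

/-! ### Moments of the least squares coefficients of a Gaussian design -/

section Moments

variable {n d : ℕ}

lemma measurable_gram_inv_apply (i j : Fin d) :
    Measurable fun g : Fin n → EuclideanSpace ℝ (Fin d) =>
      ((rowMatrix g).transpose * rowMatrix g)⁻¹ i j := by
  have hG : Continuous fun g : Fin n → EuclideanSpace ℝ (Fin d) =>
      (rowMatrix g).transpose * rowMatrix g := by
    refine continuous_matrix fun i j => ?_
    simp only [rowMatrix, Matrix.mul_apply, Matrix.transpose_apply, Matrix.of_apply]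
    fun_prop
  simp only [Matrix.inv_def, Ring.inverse_eq_inv', Matrix.smul_apply, smul_eq_mul]
  exact hG.matrix_det.measurable.inv.mul (hG.matrix_adjugate.matrix_elem i j).measurable

lemma measurable_olsDual (h : EuclideanSpace ℝ (Fin d)) :
    Measurable fun g : Fin n → EuclideanSpace ℝ (Fin d) => olsDual g h := by
  refine (WithLp.measurable_toLp 2 _).comp (measurable_pi_iff.2 fun i => ?_)
  simp only [Matrix.mulVec, dotProduct, rowMatrix, Matrix.of_apply]
  refine Finset.measurable_sum _ fun j _ => Measurable.mul (by fun_prop) ?_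
  refine Finset.measurable_sum _ fun k _ => Measurable.mul_const ?_ _
  exact measurable_gram_inv_apply j k

lemma measurable_olsCoeff :
    Measurable fun p : (Fin n → EuclideanSpace ℝ (Fin d)) × EuclideanSpace ℝ (Fin n) =>
      olsCoeff p.1 p.2 := by
  refine (WithLp.measurable_toLp 2 _).comp (measurable_pi_iff.2 fun i => ?_)
  simp only [Matrix.mulVec, dotProduct]
  refine Finset.measurable_sum _ fun j _ => Measurable.mul ?_ ?_
  · exact (measurable_gram_inv_apply i j).comp measurable_fst
  · simp only [rowMatrix, Matrix.of_apply, Matrix.transpose_apply]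
    fun_prop

variable (n d) in
/-- The joint law of a standard Gaussian design and an independent standard Gaussian response. -/
noncomputable def designLaw :
    Measure ((Fin n → EuclideanSpace ℝ (Fin d)) × EuclideanSpace ℝ (Fin n)) :=
  (Measure.pi fun _ => stdGaussian (EuclideanSpace ℝ (Fin d))).prod
    (stdGaussian (EuclideanSpace ℝ (Fin n)))

instance : IsProbabilityMeasure (designLaw n d) := by
  unfold designLaw; infer_instance

/-- A standard Gaussian design is obtained from independent standard Gaussian designs of a
line and of its orthogonal complement. -/
lemma map_smul_add_pi_stdGaussian {h : EuclideanSpace ℝ (Fin d)} (hh : ‖h‖ = 1) :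
    ((Measure.pi fun _ : Fin n => stdGaussian (ℝ ∙ h)ᗮ).prod
      (stdGaussian (EuclideanSpace ℝ (Fin n)))).map
      (fun p i => p.2 i • h + (p.1 i : EuclideanSpace ℝ (Fin d)))
      = Measure.pi fun _ : Fin n => stdGaussian (EuclideanSpace ℝ (Fin d)) := by
  have h1 := Measure.pi_map_pi (ι := Fin n)
    (μ := fun _ => (stdGaussian (ℝ ∙ h)ᗮ).prod (gaussianReal 0 1))
    (f := fun _ (p : (ℝ ∙ h)ᗮ × ℝ) => p.2 • h + (p.1 : EuclideanSpace ℝ (Fin d)))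
    (fun _ => by fun_prop)
  simp_rw [map_smul_add_stdGaussian hh] at h1
  rw [← h1, ← (measurePreserving_arrowProdEquivProdArrow (ℝ ∙ h)ᗮ ℝ (Fin n)
    (fun _ => stdGaussian (ℝ ∙ h)ᗮ) (fun _ => gaussianReal 0 1)).symm.map_eq,
    ← map_pi_eq_stdGaussian, Measure.map_map (by fun_prop) (by fun_prop)]
  conv_lhs => rw [← Measure.map_id (μ := Measure.pi fun _ : Fin n => stdGaussian (ℝ ∙ h)ᗮ)]
  rw [Measure.map_prod_map _ _ measurable_id (by fun_prop),
    Measure.map_map (by fun_prop) (by fun_prop)]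
  rfl

/-- The squared norm of `G (Gᵀ G)⁻¹ h`, for a unit vector `h`, has the law of the inverse of a
chi-squared variable with `n - d + 1` degrees of freedom. -/
lemma lintegral_norm_sq_olsDual {h : EuclideanSpace ℝ (Fin d)} (hh : ‖h‖ = 1) (hnd : d ≤ n)
    {f : ℝ → ENNReal} (hf : Measurable f) {C : ENNReal}
    (hC : ∀ V : Submodule ℝ (EuclideanSpace ℝ (Fin n)), Module.finrank ℝ V + d = n + 1 →
      ∫⁻ x, f ((‖x‖ ^ 2)⁻¹) ∂(stdGaussian V) = C) :
    ∫⁻ g, f (‖olsDual g h‖ ^ 2)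
      ∂(Measure.pi fun _ : Fin n => stdGaussian (EuclideanSpace ℝ (Fin d))) = C := by
  have hm : Measurable fun g : Fin n → EuclideanSpace ℝ (Fin d) => f (‖olsDual g h‖ ^ 2) :=
    hf.comp ((measurable_olsDual h).norm.pow_const 2)
  have hT : Measurable fun (p : (Fin n → (ℝ ∙ h)ᗮ) × EuclideanSpace ℝ (Fin n)) (i : Fin n) =>
      p.2 i • h + (p.1 i : EuclideanSpace ℝ (Fin d)) := by fun_prop
  have hspan := ae_span_eq_top_pi_stdGaussian (E := EuclideanSpace ℝ (Fin d)) (n := n) (by simpa)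
  rw [← map_smul_add_pi_stdGaussian hh] at hspan ⊢
  have hmT : Measurable fun p : (Fin n → (ℝ ∙ h)ᗮ) × EuclideanSpace ℝ (Fin n) =>
      f (‖olsDual (fun i => p.2 i • h + (p.1 i : EuclideanSpace ℝ (Fin d))) h‖ ^ 2) := hm.comp hT
  rw [lintegral_map hm hT, lintegral_prod _ hmT.aemeasurable]
  have hspan2 := Measure.ae_ae_of_ae_prod (ae_of_ae_map hT.aemeasurable hspan)
  have key : ∀ᵐ w ∂(Measure.pi fun _ : Fin n => stdGaussian (ℝ ∙ h)ᗮ),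
      ∫⁻ c, f (‖olsDual (fun i => c i • h + (w i : EuclideanSpace ℝ (Fin d))) h‖ ^ 2)
        ∂(stdGaussian (EuclideanSpace ℝ (Fin n))) = C := by
    filter_upwards [hspan2] with w hw
    -- a single full rank extension of `w` determines the dimension of the orthogonal complement
    obtain ⟨c, hc⟩ := hw.exists
    rw [← hC _ (finrank_orthogonal_range_rowMap hh hc), ← map_orthogonalProjection_stdGaussian,
      lintegral_map (by fun_prop) (by fun_prop)]
    refine lintegral_congr_ae ?_
    filter_upwards [hw] with c hc
    rw [norm_sq_olsDual hh hc]
  rw [lintegral_congr_ae key]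
  simp

lemma olsDual_smul (g : Fin n → EuclideanSpace ℝ (Fin d)) (a : ℝ) (h : EuclideanSpace ℝ (Fin d)) :
    olsDual g (a • h) = a • olsDual g h := by
  ext i
  simp [olsDual, Matrix.mulVec_smul]

lemma lintegral_norm_sq_olsDual_eq (hnd : d + 1 < n) (h : EuclideanSpace ℝ (Fin d)) :
    ∫⁻ g, ENNReal.ofReal (‖olsDual g h‖ ^ 2)
      ∂(Measure.pi fun _ : Fin n => stdGaussian (EuclideanSpace ℝ (Fin d)))
      = ENNReal.ofReal (‖h‖ ^ 2 * (1 / ((n : ℝ) - d - 1))) := by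
  rcases eq_or_ne h 0 with rfl | h0
  · simp [olsDual]
  have h1 := lintegral_norm_sq_olsDual (n := n) (h := ‖h‖⁻¹ • h) (norm_smul_inv_norm h0) (by omega)
    (f := ENNReal.ofReal) ENNReal.measurable_ofReal
    (C := ENNReal.ofReal (1 / ((n : ℝ) - d - 1))) (fun V hV => by
      rw [lintegral_norm_sq_inv_stdGaussian (by omega)]
      have : (Module.finrank ℝ V : ℝ) + d = n + 1 := by exact_mod_cast hV
      rw [show (Module.finrank ℝ V : ℝ) - 2 = n - d - 1 by linarith])
  have e : ∀ g : Fin n → EuclideanSpace ℝ (Fin d),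
      ‖olsDual g h‖ ^ 2 = ‖h‖ ^ 2 * ‖olsDual g (‖h‖⁻¹ • h)‖ ^ 2 := by
    intro g
    rw [olsDual_smul, norm_smul, norm_inv, norm_norm]
    have : ‖h‖ ≠ 0 := by simpa
    field_simp
  simp_rw [e, ENNReal.ofReal_mul (sq_nonneg ‖h‖)]
  rw [lintegral_const_mul _ ((measurable_olsDual _).norm.pow_const 2).ennreal_ofReal, h1]

lemma lintegral_norm_pow_four_olsDual_eq (hnd : d + 3 < n) (h : EuclideanSpace ℝ (Fin d)) :
    ∫⁻ g, ENNReal.ofReal (‖olsDual g h‖ ^ 4)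
      ∂(Measure.pi fun _ : Fin n => stdGaussian (EuclideanSpace ℝ (Fin d)))
      = ENNReal.ofReal (‖h‖ ^ 4 * (1 / (((n : ℝ) - d - 1) * ((n : ℝ) - d - 3)))) := by
  rcases eq_or_ne h 0 with rfl | h0
  · simp [olsDual]
  have h1 := lintegral_norm_sq_olsDual (n := n) (h := ‖h‖⁻¹ • h) (norm_smul_inv_norm h0) (by omega)
    (f := fun x => ENNReal.ofReal (x ^ 2)) (by fun_prop)
    (C := ENNReal.ofReal (1 / (((n : ℝ) - d - 1) * ((n : ℝ) - d - 3)))) (fun V hV => by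
      have e : ∀ x : V, ((‖x‖ ^ 2)⁻¹) ^ 2 = (‖x‖ ^ 4)⁻¹ := fun x => by
        rw [inv_pow, ← pow_mul]
      simp_rw [e]
      rw [lintegral_norm_pow_four_inv_stdGaussian (by omega)]
      have : (Module.finrank ℝ V : ℝ) + d = n + 1 := by exact_mod_cast hV
      rw [show (Module.finrank ℝ V : ℝ) - 2 = n - d - 1 by linarith,
        show (Module.finrank ℝ V : ℝ) - 4 = n - d - 3 by linarith])
  have e : ∀ g : Fin n → EuclideanSpace ℝ (Fin d),
      ‖olsDual g h‖ ^ 4 = ‖h‖ ^ 4 * (‖olsDual g (‖h‖⁻¹ • h)‖ ^ 2) ^ 2 := by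
    intro g
    rw [olsDual_smul, norm_smul, norm_inv, norm_norm]
    have : ‖h‖ ≠ 0 := by simpa
    field_simp
  simp_rw [e, ENNReal.ofReal_mul (show 0 ≤ ‖h‖ ^ 4 by positivity)]
  rw [lintegral_const_mul _ (((measurable_olsDual _).norm.pow_const 2).pow_const 2).ennreal_ofReal,
    h1]

lemma measurable_inner_olsCoeff (h : EuclideanSpace ℝ (Fin d)) :
    Measurable fun p : (Fin n → EuclideanSpace ℝ (Fin d)) × EuclideanSpace ℝ (Fin n) =>
      ⟪olsCoeff p.1 p.2, h⟫ :=
  measurable_olsCoeff.inner measurable_const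

lemma lintegral_inner_olsCoeff_sq (hnd : d + 1 < n) (h : EuclideanSpace ℝ (Fin d)) :
    ∫⁻ p, ENNReal.ofReal (⟪olsCoeff p.1 p.2, h⟫ ^ 2) ∂(designLaw n d)
      = ENNReal.ofReal (‖h‖ ^ 2 * (1 / ((n : ℝ) - d - 1))) := by
  rw [designLaw, lintegral_prod _
    ((measurable_inner_olsCoeff h).pow_const 2).ennreal_ofReal.aemeasurable]
  simp_rw [inner_olsCoeff, lintegral_inner_sq_stdGaussian]
  exact lintegral_norm_sq_olsDual_eq hnd h

lemma lintegral_inner_olsCoeff_pow_four (hnd : d + 3 < n) (h : EuclideanSpace ℝ (Fin d)) :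
    ∫⁻ p, ENNReal.ofReal (⟪olsCoeff p.1 p.2, h⟫ ^ 4) ∂(designLaw n d)
      = ENNReal.ofReal (3 * ‖h‖ ^ 4 * (1 / (((n : ℝ) - d - 1) * ((n : ℝ) - d - 3)))) := by
  rw [designLaw, lintegral_prod _
    ((measurable_inner_olsCoeff h).pow_const 4).ennreal_ofReal.aemeasurable]
  simp_rw [inner_olsCoeff, lintegral_inner_pow_four_stdGaussian,
    ENNReal.ofReal_mul (show (0 : ℝ) ≤ 3 by norm_num)]
  rw [lintegral_const_mul _ ((measurable_olsDual _).norm.pow_const 4).ennreal_ofReal,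
    lintegral_norm_pow_four_olsDual_eq hnd, ← ENNReal.ofReal_mul (by norm_num), mul_assoc]

lemma integrable_inner_olsCoeff_sq (hnd : d + 1 < n) (h : EuclideanSpace ℝ (Fin d)) :
    Integrable (fun p => ⟪olsCoeff p.1 p.2, h⟫ ^ 2) (designLaw n d) := by
  refine ⟨((measurable_inner_olsCoeff h).pow_const 2).aestronglyMeasurable, ?_⟩
  rw [hasFiniteIntegral_iff_ofReal (ae_of_all _ fun _ => by positivity),
    lintegral_inner_olsCoeff_sq hnd]
  exact ENNReal.ofReal_lt_top

lemma integral_inner_olsCoeff_sq (hnd : d + 1 < n) (h : EuclideanSpace ℝ (Fin d)) :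
    ∫ p, ⟪olsCoeff p.1 p.2, h⟫ ^ 2 ∂(designLaw n d) = ‖h‖ ^ 2 * (1 / ((n : ℝ) - d - 1)) := by
  have : (d : ℝ) + 1 < n := by exact_mod_cast hnd
  rw [integral_eq_lintegral_of_nonneg_ae (ae_of_all _ fun _ => by positivity)
    ((measurable_inner_olsCoeff h).pow_const 2).aestronglyMeasurable,
    lintegral_inner_olsCoeff_sq hnd, ENNReal.toReal_ofReal]
  exact mul_nonneg (by positivity) (one_div_nonneg.2 (by linarith))

lemma integrable_inner_olsCoeff_pow_four (hnd : d + 3 < n) (h : EuclideanSpace ℝ (Fin d)) :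
    Integrable (fun p => ⟪olsCoeff p.1 p.2, h⟫ ^ 4) (designLaw n d) := by
  refine ⟨((measurable_inner_olsCoeff h).pow_const 4).aestronglyMeasurable, ?_⟩
  rw [hasFiniteIntegral_iff_ofReal (ae_of_all _ fun _ => by positivity),
    lintegral_inner_olsCoeff_pow_four hnd]
  exact ENNReal.ofReal_lt_top

lemma integral_inner_olsCoeff_pow_four (hnd : d + 3 < n) (h : EuclideanSpace ℝ (Fin d)) :
    ∫ p, ⟪olsCoeff p.1 p.2, h⟫ ^ 4 ∂(designLaw n d)
      = 3 * ‖h‖ ^ 4 * (1 / (((n : ℝ) - d - 1) * ((n : ℝ) - d - 3))) := by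
  have : (d : ℝ) + 3 < n := by exact_mod_cast hnd
  rw [integral_eq_lintegral_of_nonneg_ae (ae_of_all _ fun _ => by positivity)
    ((measurable_inner_olsCoeff h).pow_const 4).aestronglyMeasurable,
    lintegral_inner_olsCoeff_pow_four hnd, ENNReal.toReal_ofReal]
  exact mul_nonneg (by positivity)
    (one_div_nonneg.2 (mul_nonneg (by linarith) (by linarith)))

lemma norm_sq_eq_sum_inner (v : EuclideanSpace ℝ (Fin d)) :
    ‖v‖ ^ 2 = ∑ i, ⟪v, EuclideanSpace.basisFun (Fin d) ℝ i⟫ ^ 2 :=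
  ((EuclideanSpace.basisFun (Fin d) ℝ).sum_sq_inner_left v).symm

lemma integrable_norm_sq_olsCoeff (hnd : d + 1 < n) :
    Integrable (fun p => ‖olsCoeff p.1 p.2‖ ^ 2) (designLaw n d) := by
  simp_rw [norm_sq_eq_sum_inner]
  exact integrable_finsetSum _ fun i _ => integrable_inner_olsCoeff_sq hnd _

lemma integral_norm_sq_olsCoeff (hnd : d + 1 < n) :
    ∫ p, ‖olsCoeff p.1 p.2‖ ^ 2 ∂(designLaw n d) = d / ((n : ℝ) - d - 1) := by
  simp_rw [norm_sq_eq_sum_inner]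
  rw [integral_finsetSum _ fun i _ => integrable_inner_olsCoeff_sq hnd _]
  simp_rw [integral_inner_olsCoeff_sq hnd]
  simp
  ring

/-- Polarization of a mixed fourth moment. -/
lemma sq_mul_sq_eq (a b : ℝ) :
    a ^ 2 * b ^ 2 = 1 / 12 * ((a + b) ^ 4 + (a - b) ^ 4) - 1 / 6 * (a ^ 4 + b ^ 4) := by
  ring

lemma integrable_inner_sq_mul_inner_sq (hnd : d + 3 < n) (u v : EuclideanSpace ℝ (Fin d)) :
    Integrable (fun p => ⟪olsCoeff p.1 p.2, u⟫ ^ 2 * ⟪olsCoeff p.1 p.2, v⟫ ^ 2)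
      (designLaw n d) := by
  simp_rw [sq_mul_sq_eq, ← inner_add_right, ← inner_sub_right]
  have h := integrable_inner_olsCoeff_pow_four hnd
  exact (((h _).add (h _)).const_mul _).sub (((h _).add (h _)).const_mul _)

lemma integral_inner_sq_mul_inner_sq (hnd : d + 3 < n) {u v : EuclideanSpace ℝ (Fin d)}
    (hu : ‖u‖ = 1) (hv : ‖v‖ = 1) (huv : ⟪u, v⟫ = 0) :
    ∫ p, ⟪olsCoeff p.1 p.2, u⟫ ^ 2 * ⟪olsCoeff p.1 p.2, v⟫ ^ 2 ∂(designLaw n d)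
      = 1 / (((n : ℝ) - d - 1) * ((n : ℝ) - d - 3)) := by
  simp_rw [sq_mul_sq_eq, ← inner_add_right, ← inner_sub_right]
  have h := integrable_inner_olsCoeff_pow_four hnd
  have h' : ∀ a b : EuclideanSpace ℝ (Fin d), Integrable
      (fun p => ⟪olsCoeff p.1 p.2, a⟫ ^ 4 + ⟪olsCoeff p.1 p.2, b⟫ ^ 4) (designLaw n d) :=
    fun a b => (h a).add (h b)
  rw [integral_sub ((h' _ _).const_mul _) ((h' _ _).const_mul _),
    integral_const_mul, integral_const_mul, integral_add (h _) (h _), integral_add (h _) (h _)]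
  simp_rw [integral_inner_olsCoeff_pow_four hnd]
  have hp : ‖u + v‖ ^ 4 = 4 := by
    rw [show ‖u + v‖ ^ 4 = (‖u + v‖ ^ 2) ^ 2 by ring, norm_add_sq_real, hu, hv, huv]; norm_num
  have hm : ‖u - v‖ ^ 4 = 4 := by
    rw [show ‖u - v‖ ^ 4 = (‖u - v‖ ^ 2) ^ 2 by ring, norm_sub_sq_real, hu, hv, huv]; norm_num
  rw [hp, hm, hu, hv]
  ring

lemma norm_pow_four_eq_sum_inner (v : EuclideanSpace ℝ (Fin d)) :
    ‖v‖ ^ 4 = ∑ i, ∑ j, ⟪v, EuclideanSpace.basisFun (Fin d) ℝ i⟫ ^ 2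
      * ⟪v, EuclideanSpace.basisFun (Fin d) ℝ j⟫ ^ 2 := by
  rw [show ‖v‖ ^ 4 = ‖v‖ ^ 2 * ‖v‖ ^ 2 by ring, norm_sq_eq_sum_inner, Finset.sum_mul_sum]

lemma integrable_norm_pow_four_olsCoeff (hnd : d + 3 < n) :
    Integrable (fun p => ‖olsCoeff p.1 p.2‖ ^ 4) (designLaw n d) := by
  simp_rw [norm_pow_four_eq_sum_inner]
  exact integrable_finsetSum _ fun i _ => integrable_finsetSum _ fun j _ =>
    integrable_inner_sq_mul_inner_sq hnd _ _

lemma integral_norm_pow_four_olsCoeff (hnd : d + 3 < n) :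
    ∫ p, ‖olsCoeff p.1 p.2‖ ^ 4 ∂(designLaw n d)
      = d * (d + 2) / (((n : ℝ) - d - 1) * ((n : ℝ) - d - 3)) := by
  simp_rw [norm_pow_four_eq_sum_inner]
  rw [integral_finsetSum _ fun i _ => integrable_finsetSum _ fun j _ =>
    integrable_inner_sq_mul_inner_sq hnd _ _]
  have hb := (EuclideanSpace.basisFun (Fin d) ℝ).orthonormal
  have hi : ∀ i, ∫ p, ∑ j, ⟪olsCoeff p.1 p.2, EuclideanSpace.basisFun (Fin d) ℝ i⟫ ^ 2
      * ⟪olsCoeff p.1 p.2, EuclideanSpace.basisFun (Fin d) ℝ j⟫ ^ 2 ∂(designLaw n d)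
      = (d + 2) * (1 / (((n : ℝ) - d - 1) * ((n : ℝ) - d - 3))) := by
    intro i
    rw [integral_finsetSum _ fun j _ => integrable_inner_sq_mul_inner_sq hnd _ _]
    have hj : ∀ j, ∫ p, ⟪olsCoeff p.1 p.2, EuclideanSpace.basisFun (Fin d) ℝ i⟫ ^ 2
        * ⟪olsCoeff p.1 p.2, EuclideanSpace.basisFun (Fin d) ℝ j⟫ ^ 2 ∂(designLaw n d)
        = (1 + if i = j then 2 else 0) * (1 / (((n : ℝ) - d - 1) * ((n : ℝ) - d - 3))) := by
      intro j
      split_ifs with hij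
      · subst hij
        simp_rw [← pow_add]
        rw [integral_inner_olsCoeff_pow_four hnd, hb.1 i]
        ring
      · rw [integral_inner_sq_mul_inner_sq hnd (hb.1 i) (hb.1 j) (hb.2 hij)]
        ring
    simp_rw [hj]
    rw [← Finset.sum_mul, Finset.sum_add_distrib]
    simp
  simp_rw [hi]
  rw [Finset.sum_const, Finset.card_univ, Fintype.card_fin, nsmul_eq_mul]
  ring

variable (n d) in
/-- The variance of `‖(Gᵀ G)⁻¹ Gᵀ r‖²` for a standard Gaussian design and response. -/
noncomputable def olsVariance : ℝ :=
  d * (d + 2) / (((n : ℝ) - d - 1) * ((n : ℝ) - d - 3)) - (d / ((n : ℝ) - d - 1)) ^ 2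

/-- The squared norm of the coefficients deviates little from its mean. -/
lemma integral_abs_norm_sq_olsCoeff_sub_le (hnd : d + 3 < n) :
    Integrable (fun p => |‖olsCoeff p.1 p.2‖ ^ 2 - d / ((n : ℝ) - d - 1)|) (designLaw n d) ∧
    ∫ p, |‖olsCoeff p.1 p.2‖ ^ 2 - d / ((n : ℝ) - d - 1)| ∂(designLaw n d)
      ≤ √(olsVariance n d) := by
  set μ : ℝ := d / ((n : ℝ) - d - 1) with hμ
  have h2 := integrable_norm_sq_olsCoeff (n := n) (d := d) (by omega)
  have h4 := integrable_norm_pow_four_olsCoeff hnd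
  have e : ∀ p : (Fin n → EuclideanSpace ℝ (Fin d)) × EuclideanSpace ℝ (Fin n),
      (‖olsCoeff p.1 p.2‖ ^ 2 - μ) ^ 2
        = ‖olsCoeff p.1 p.2‖ ^ 4 - 2 * μ * ‖olsCoeff p.1 p.2‖ ^ 2 + μ ^ 2 := fun p => by ring
  have h42 : Integrable (fun p => ‖olsCoeff p.1 p.2‖ ^ 4 - 2 * μ * ‖olsCoeff p.1 p.2‖ ^ 2)
      (designLaw n d) := h4.sub (h2.const_mul _)
  have hsq : Integrable (fun p => (‖olsCoeff p.1 p.2‖ ^ 2 - μ) ^ 2) (designLaw n d) := by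
    simp_rw [e]
    exact h42.add (integrable_const _)
  have hint : ∫ p, (‖olsCoeff p.1 p.2‖ ^ 2 - μ) ^ 2 ∂(designLaw n d) = olsVariance n d := by
    simp_rw [e]
    rw [integral_add h42 (integrable_const _),
      integral_sub h4 (h2.const_mul _), integral_const_mul, integral_norm_pow_four_olsCoeff hnd,
      integral_norm_sq_olsCoeff (by omega), ← hμ, olsVariance, ← hμ]
    simp
    ring
  have habs : Integrable (fun p => |‖olsCoeff p.1 p.2‖ ^ 2 - μ|) (designLaw n d) :=
    (h2.sub (integrable_const μ)).abs
  refine ⟨habs, Real.le_sqrt_of_sq_le ?_⟩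
  have hL : MemLp (fun p => |‖olsCoeff p.1 p.2‖ ^ 2 - μ|) 2 (designLaw n d) := by
    rw [memLp_two_iff_integrable_sq habs.aestronglyMeasurable]
    simpa only [sq_abs] using hsq
  have hv := variance_nonneg (fun p => |‖olsCoeff p.1 p.2‖ ^ 2 - μ|) (designLaw n d)
  rw [variance_eq_sub hL] at hv
  simp only [Pi.pow_apply, sq_abs] at hv
  rw [hint] at hv
  linarith

end Moments

/-! ### The generalization error and the Wiener filter -/

section Error

variable {n d : ℕ} {Sig Sigz : Matrix (Fin d) (Fin d) ℝ}

lemma quadratic_add {S : Matrix (Fin d) (Fin d) ℝ} (hS : S.IsHermitian) (u v : Fin d → ℝ) :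
    (u + v) ⬝ᵥ S.mulVec (u + v)
      = u ⬝ᵥ S.mulVec u + 2 * (v ⬝ᵥ S.mulVec u) + v ⬝ᵥ S.mulVec v := by
  have h : u ⬝ᵥ S.mulVec v = v ⬝ᵥ S.mulVec u := by
    rw [Matrix.dotProduct_mulVec, ← Matrix.mulVec_transpose,
      ← Matrix.conjTranspose_eq_transpose_of_trivial, hS.eq, dotProduct_comm]
  rw [Matrix.mulVec_add, add_dotProduct, dotProduct_add, dotProduct_add, h]
  ring

lemma quadratic_nonneg {S : Matrix (Fin d) (Fin d) ℝ} (hS : S.PosSemidef) (u : Fin d → ℝ) :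
    0 ≤ u ⬝ᵥ S.mulVec u := by
  simpa using hS.dotProduct_mulVec_nonneg u

/-- The expected squared error `E (⟨w, x + z⟩ - ⟨a, x⟩)²` of the linear prediction of `⟨a, x⟩`
from `x + z` with coefficients `w`. -/
def predictionError (Sig Sigz : Matrix (Fin d) (Fin d) ℝ) (a w : Fin d → ℝ) : ℝ :=
  (w - a) ⬝ᵥ Sig.mulVec (w - a) + w ⬝ᵥ Sigz.mulVec w

lemma predictionError_nonneg (hSig : Sig.PosSemidef) (hSigz : Sigz.PosSemidef)
    (a w : Fin d → ℝ) : 0 ≤ predictionError Sig Sigz a w :=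
  add_nonneg (quadratic_nonneg hSig _) (quadratic_nonneg hSigz _)

/-- The prediction error grows quadratically around a solution of the normal equations. -/
lemma predictionError_eq_add (hSig : Sig.IsHermitian) (hSigz : Sigz.IsHermitian)
    {a w₀ : Fin d → ℝ} (h₀ : (Sig + Sigz).mulVec w₀ = Sig.mulVec a) (w : Fin d → ℝ) :
    predictionError Sig Sigz a w
      = predictionError Sig Sigz a w₀ + (w - w₀) ⬝ᵥ (Sig + Sigz).mulVec (w - w₀) := by
  have hc : (w - w₀) ⬝ᵥ Sig.mulVec (w₀ - a) + (w - w₀) ⬝ᵥ Sigz.mulVec w₀ = 0 := by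
    rw [Matrix.add_mulVec] at h₀
    rw [← dotProduct_add, Matrix.mulVec_sub, ← h₀]
    simp
  have h1 := quadratic_add hSig (w₀ - a) (w - w₀)
  have h2 := quadratic_add hSigz w₀ (w - w₀)
  rw [show w₀ - a + (w - w₀) = w - a by abel] at h1
  rw [show w₀ + (w - w₀) = w by abel] at h2
  rw [predictionError, predictionError, h1, h2, Matrix.add_mulVec, dotProduct_add]
  linear_combination 2 * hc

lemma memLp_inner_multivariateGaussian (S : Matrix (Fin d) (Fin d) ℝ)
    (u : EuclideanSpace ℝ (Fin d)) :
    MemLp (fun x => ⟪u, x⟫) 2 (multivariateGaussian 0 S) :=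
  (IsGaussian.memLp_two_id (μ := multivariateGaussian 0 S)).const_inner u

lemma integral_inner_multivariateGaussian (S : Matrix (Fin d) (Fin d) ℝ)
    (u : EuclideanSpace ℝ (Fin d)) : ∫ x, ⟪u, x⟫ ∂(multivariateGaussian 0 S) = 0 := by
  rw [integral_inner (f := fun x => x) IsGaussian.integrable_id,
    integral_id_multivariateGaussian, inner_zero_right]

lemma integral_inner_sq_multivariateGaussian {S : Matrix (Fin d) (Fin d) ℝ} (hS : S.PosSemidef)
    (u : EuclideanSpace ℝ (Fin d)) :
    ∫ x, ⟪u, x⟫ ^ 2 ∂(multivariateGaussian 0 S) = u.ofLp ⬝ᵥ S.mulVec u.ofLp := by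
  have h := covarianceBilin_multivariateGaussian (μ := 0) hS u u
  rw [covarianceBilin_apply_eq_cov IsGaussian.memLp_two_id, covariance_self (by fun_prop),
    variance_of_integral_eq_zero (by fun_prop) (integral_inner_multivariateGaussian S u)] at h
  exact h

lemma integrable_inner_add_sq (S : Matrix (Fin d) (Fin d) ℝ)
    (u : EuclideanSpace ℝ (Fin d)) (b : ℝ) :
    Integrable (fun x => (⟪u, x⟫ + b) ^ 2) (multivariateGaussian 0 S) :=
  ((memLp_inner_multivariateGaussian S u).add (memLp_const b)).integrable_sq

lemma integral_inner_add_sq_multivariateGaussian {S : Matrix (Fin d) (Fin d) ℝ}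
    (hS : S.PosSemidef) (u : EuclideanSpace ℝ (Fin d)) (b : ℝ) :
    ∫ x, (⟪u, x⟫ + b) ^ 2 ∂(multivariateGaussian 0 S)
      = u.ofLp ⬝ᵥ S.mulVec u.ofLp + b ^ 2 := by
  have h1 := (memLp_inner_multivariateGaussian S u).integrable (by norm_num)
  have h2 := (memLp_inner_multivariateGaussian S u).integrable_sq
  have e : ∀ x : EuclideanSpace ℝ (Fin d),
      (⟪u, x⟫ + b) ^ 2 = ⟪u, x⟫ ^ 2 + (2 * b * ⟪u, x⟫ + b ^ 2) := fun x => by ring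
  have h3 : Integrable (fun x => 2 * b * ⟪u, x⟫ + b ^ 2) (multivariateGaussian 0 S) :=
    (h1.const_mul _).add (integrable_const _)
  simp_rw [e]
  rw [integral_add h2 h3, integral_add (h1.const_mul _) (integrable_const _), integral_const_mul,
    integral_inner_multivariateGaussian, integral_inner_sq_multivariateGaussian hS]
  simp

lemma genError_eq_sum (hSig : Sig.PosSemidef) (hSigz : Sigz.PosSemidef)
    (W : Matrix (Fin d) (Fin d) ℝ) :
    genError Sig Sigz W = ∑ k, predictionError Sig Sigz (Pi.single k 1) (W.col k) := by
  set u : Fin d → EuclideanSpace ℝ (Fin d) := fun k => WithLp.toLp 2 (W.col k - Pi.single k 1)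
  set v : Fin d → EuclideanSpace ℝ (Fin d) := fun k => WithLp.toLp 2 (W.col k)
  have e : ∀ x z : EuclideanSpace ℝ (Fin d),
      ‖Matrix.toEuclideanCLM (𝕜 := ℝ) W.transpose (x + z) - x‖ ^ 2
        = ∑ k, (⟪u k, x⟫ + ⟪v k, z⟫) ^ 2 := by
    intro x z
    rw [EuclideanSpace.real_norm_sq_eq]
    refine Finset.sum_congr rfl fun k _ => ?_
    congr 1
    simp [u, v, EuclideanSpace.inner_eq_star_dotProduct, Matrix.mulVec, dotProduct_sub,
      Matrix.transpose_apply, Matrix.col]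
    simp [dotProduct, mul_comm]
    ring
  simp_rw [genError, e]
  have h1 : ∀ z : EuclideanSpace ℝ (Fin d),
      ∫ x, ∑ k, (⟪u k, x⟫ + ⟪v k, z⟫) ^ 2 ∂(multivariateGaussian 0 Sig)
        = ∑ k, (⟪v k, z⟫ ^ 2 + (u k).ofLp ⬝ᵥ Sig.mulVec (u k).ofLp) := by
    intro z
    rw [integral_finsetSum _ fun k _ => integrable_inner_add_sq Sig _ _]
    simp_rw [integral_inner_add_sq_multivariateGaussian hSig, add_comm]
  have h2 : ∀ k, Integrable (fun z => ⟪v k, z⟫ ^ 2) (multivariateGaussian 0 Sigz) := fun k =>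
    (memLp_inner_multivariateGaussian Sigz (v k)).integrable_sq
  have h3 : ∀ k, Integrable (fun z => ⟪v k, z⟫ ^ 2 + (u k).ofLp ⬝ᵥ Sig.mulVec (u k).ofLp)
      (multivariateGaussian 0 Sigz) := fun k => (h2 k).add (integrable_const _)
  simp_rw [h1]
  rw [integral_finsetSum _ fun k _ => h3 k]
  refine Finset.sum_congr rfl fun k _ => ?_
  rw [integral_add (h2 k) (integrable_const _), integral_inner_sq_multivariateGaussian hSigz,
    predictionError, add_comm]
  simp [u, v]

/-- The columns of the Wiener filter solve the normal equations. -/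
lemma wienerFilter_col (hSig : Sig.PosDef) (hSigz : Sigz.PosSemidef) (k : Fin d) :
    (Sig + Sigz).mulVec ((wienerFilter Sig Sigz).col k) = Sig.mulVec (Pi.single k 1) := by
  have hu : IsUnit (Sig + Sigz).det := (hSig.add_posSemidef hSigz).det_pos.ne'.isUnit
  rw [Matrix.mulVec_single_one, wienerFilter]
  have : (Sig + Sigz) * ((Sig + Sigz)⁻¹ * Sig) = Sig := by
    rw [← Matrix.mul_assoc, Matrix.mul_nonsing_inv _ hu, Matrix.one_mul]
  ext i
  exact congrFun (congrFun this i) k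

lemma genError_eq_add (hSig : Sig.PosDef) (hSigz : Sigz.PosSemidef)
    (W : Matrix (Fin d) (Fin d) ℝ) :
    genError Sig Sigz W = genError Sig Sigz (wienerFilter Sig Sigz)
      + ∑ k, (W.col k - (wienerFilter Sig Sigz).col k) ⬝ᵥ
        (Sig + Sigz).mulVec (W.col k - (wienerFilter Sig Sigz).col k) := by
  rw [genError_eq_sum hSig.posSemidef hSigz, genError_eq_sum hSig.posSemidef hSigz,
    ← Finset.sum_add_distrib]
  exact Finset.sum_congr rfl fun k _ => predictionError_eq_add hSig.isHermitian hSigz.isHermitian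
    (wienerFilter_col hSig hSigz k) _

lemma genError_wienerFilter_le (hSig : Sig.PosDef) (hSigz : Sigz.PosSemidef)
    (W : Matrix (Fin d) (Fin d) ℝ) :
    genError Sig Sigz (wienerFilter Sig Sigz) ≤ genError Sig Sigz W := by
  rw [genError_eq_add hSig hSigz W]
  exact le_add_of_nonneg_right (Finset.sum_nonneg fun k _ =>
    quadratic_nonneg (hSig.posSemidef.add hSigz) _)

lemma genError_wienerFilter (hSig : Sig.PosDef) (hSigz : Sigz.PosSemidef) :
    genError Sig Sigz (wienerFilter Sig Sigz) = wienerError Sig Sigz :=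
  le_antisymm (le_ciInf fun W => genError_wienerFilter_le hSig hSigz W)
    (ciInf_le ⟨_, by rintro _ ⟨W, rfl⟩; exact genError_wienerFilter_le hSig hSigz W⟩ _)

lemma wienerError_eq_sum (hSig : Sig.PosDef) (hSigz : Sigz.PosSemidef) :
    wienerError Sig Sigz
      = ∑ k, predictionError Sig Sigz (Pi.single k 1) ((wienerFilter Sig Sigz).col k) := by
  rw [← genError_wienerFilter hSig hSigz, genError_eq_sum hSig.posSemidef hSigz]

lemma wienerError_nonneg (hSig : Sig.PosDef) (hSigz : Sigz.PosSemidef) :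
    0 ≤ wienerError Sig Sigz := by
  rw [wienerError_eq_sum hSig hSigz]
  exact Finset.sum_nonneg fun k _ => predictionError_nonneg hSig.posSemidef hSigz _ _

/-- A vanishing Wiener error forces the Wiener filter to be the identity, hence the noise to
vanish. -/
lemma wienerError_pos (hSig : Sig.PosDef) (hSigz : Sigz.PosSemidef) (h0 : Sigz ≠ 0) :
    0 < wienerError Sig Sigz := by
  refine lt_of_le_of_ne (wienerError_nonneg hSig hSigz) fun h => h0 ?_
  rw [wienerError_eq_sum hSig hSigz, eq_comm, Finset.sum_eq_zero_iff_of_nonneg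
    fun k _ => predictionError_nonneg hSig.posSemidef hSigz _ _] at h
  rw [← hSigz.trace_eq_zero_iff, Matrix.trace]
  refine Finset.sum_eq_zero fun k hk => ?_
  obtain ⟨h1, h2⟩ := (add_eq_zero_iff_of_nonneg (quadratic_nonneg hSig.posSemidef _)
    (quadratic_nonneg hSigz _)).1 (h k hk)
  have hw : (wienerFilter Sig Sigz).col k - Pi.single k 1 = 0 := by
    by_contra hne
    have := hSig.dotProduct_mulVec_pos hne
    rw [star_trivial, h1] at this
    exact lt_irrefl _ this
  rw [sub_eq_zero.1 hw] at h2
  simpa using h2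

end Error

/-! ### Normal equations -/

section LeastSquares

variable {n d : ℕ}

/-- A least squares solution satisfies the normal equations. -/
lemma IsLeastSquares.normal_eq {Y X : Matrix (Fin n) (Fin d) ℝ} {W : Matrix (Fin d) (Fin d) ℝ}
    (hW : IsLeastSquares Y X W) : Y.transpose * (Y * W - X) = 0 := by
  set A := Y * W - X with hA
  set D := Y.transpose * A with hD
  have hf : ∀ t : ℝ, frobeniusSq (A + t • (Y * D))
      = frobeniusSq A + 2 * t * frobeniusSq D + t ^ 2 * frobeniusSq (Y * D) := by
    intro t
    have hAD : ∑ i, ∑ j, A i j * (Y * D) i j = frobeniusSq D := by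
      have h1 : ∑ i, ∑ j, A i j * (Y * D) i j = (A.transpose * (Y * D)).trace := by
        simp only [Matrix.trace, Matrix.diag, Matrix.mul_apply (M := A.transpose),
          Matrix.transpose_apply]
        exact Finset.sum_comm
      have h2 : frobeniusSq D = (D.transpose * D).trace := by
        simp only [Matrix.trace, Matrix.diag, Matrix.mul_apply (M := D.transpose),
          Matrix.transpose_apply, frobeniusSq]
        rw [Finset.sum_comm]
        simp only [sq]
      rw [h1, h2, ← Matrix.mul_assoc]
      congr 2
      rw [hD, Matrix.transpose_mul, Matrix.transpose_transpose]
    rw [← hAD]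
    simp only [frobeniusSq, Matrix.add_apply, Matrix.smul_apply, smul_eq_mul, Finset.mul_sum,
      ← Finset.sum_add_distrib]
    refine Finset.sum_congr rfl fun i _ => Finset.sum_congr rfl fun j _ => ?_
    ring
  have hmin : ∀ t : ℝ, 0 ≤ 2 * t * frobeniusSq D + t ^ 2 * frobeniusSq (Y * D) := by
    intro t
    have h := hW (W + t • D)
    rw [show Y * (W + t • D) - X = A + t • (Y * D) by
      rw [Matrix.mul_add, Matrix.mul_smul, hA]; abel, hf] at h
    linarith
  have hDnn : 0 ≤ frobeniusSq D :=
    Finset.sum_nonneg fun i _ => Finset.sum_nonneg fun j _ => sq_nonneg _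
  have hYnn : 0 ≤ frobeniusSq (Y * D) :=
    Finset.sum_nonneg fun i _ => Finset.sum_nonneg fun j _ => sq_nonneg _
  have hD0 : frobeniusSq D = 0 := by
    -- a step in the direction `-D`, short enough to be dominated by the linear term
    have h := hmin (-(frobeniusSq D / (1 + frobeniusSq (Y * D))))
    generalize frobeniusSq (Y * D) = q at h hYnn
    generalize frobeniusSq D = f at h
    have hq : 0 < 1 + q := by linarith
    have e : 2 * -(f / (1 + q)) * f + (-(f / (1 + q))) ^ 2 * q
        = -(f ^ 2 * (q + 2)) / (1 + q) ^ 2 := by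
      field_simp
      ring
    rw [e, le_div_iff₀ (by positivity), zero_mul] at h
    nlinarith [mul_nonneg (sq_nonneg f) hYnn, sq_nonneg f]
  ext i j
  have h1 := (Finset.sum_eq_zero_iff_of_nonneg
    fun i _ => Finset.sum_nonneg fun j _ => sq_nonneg (D i j)).1 hD0 i (Finset.mem_univ i)
  have h2 := (Finset.sum_eq_zero_iff_of_nonneg fun j _ => sq_nonneg (D i j)).1 h1 j
    (Finset.mem_univ j)
  simpa using h2

end LeastSquares

/-! ### The law of the whitened training sample -/

section Whitening

variable {n d : ℕ} {Sig Sigz T : Matrix (Fin d) (Fin d) ℝ} {a w₀ : Fin d → ℝ}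

/-- The noisy observation `x + z`, whitened by `(Tᵀ)⁻¹`, together with the residual
`⟨a, x⟩ - ⟨w₀, x + z⟩` of the linear prediction with coefficients `w₀`. -/
noncomputable def whitenedPair (T : Matrix (Fin d) (Fin d) ℝ) (a w₀ : Fin d → ℝ)
    (p : EuclideanSpace ℝ (Fin d) × EuclideanSpace ℝ (Fin d)) : EuclideanSpace ℝ (Fin d) × ℝ :=
  (WithLp.toLp 2 (T⁻¹.transpose.mulVec (p.1 + p.2).ofLp),
    a ⬝ᵥ p.1.ofLp - w₀ ⬝ᵥ (p.1 + p.2).ofLp)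

lemma measurable_whitenedPair : Measurable (whitenedPair T a w₀) := by
  have : Continuous (whitenedPair T a w₀) := by
    unfold whitenedPair
    fun_prop
  exact this.measurable

lemma inner_whitenedPair (p : EuclideanSpace ℝ (Fin d) × EuclideanSpace ℝ (Fin d))
    (s : EuclideanSpace ℝ (Fin d)) (r : ℝ) :
    ⟪(whitenedPair T a w₀ p).1, s⟫ + ⟪(whitenedPair T a w₀ p).2, r⟫
      = ⟪p.1, WithLp.toLp 2 (T⁻¹.mulVec s.ofLp + r • (a - w₀))⟫
        + ⟪p.2, WithLp.toLp 2 (T⁻¹.mulVec s.ofLp - r • w₀)⟫ := by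
  simp only [whitenedPair, EuclideanSpace.inner_eq_star_dotProduct, star_trivial]
  rw [Matrix.dotProduct_mulVec, Matrix.vecMul_transpose]
  simp only [WithLp.ofLp_add, add_dotProduct, sub_dotProduct, dotProduct_add, smul_dotProduct,
    smul_eq_mul, RCLike.inner_apply, conj_trivial]
  ring

/-- If `w₀` solves the normal equations, the whitened observation and the residual are independent
Gaussian variables, the latter having the prediction error as variance. -/
lemma map_whitenedPair (hSig : Sig.PosSemidef) (hSigz : Sigz.PosSemidef)
    (hT : T.transpose * T = Sig + Sigz) (hTu : IsUnit T.det)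
    (h₀ : (Sig + Sigz).mulVec w₀ = Sig.mulVec a) :
    ((multivariateGaussian 0 Sig).prod (multivariateGaussian 0 Sigz)).map (whitenedPair T a w₀)
      = (stdGaussian (EuclideanSpace ℝ (Fin d))).prod
        (gaussianReal 0 (predictionError Sig Sigz a w₀).toNNReal) := by
  have := Measure.isProbabilityMeasure_map (μ := (multivariateGaussian 0 Sig).prod
    (multivariateGaussian 0 Sigz))
    (measurable_whitenedPair (T := T) (a := a) (w₀ := w₀)).aemeasurable
  rw [← charFun_eq_prod_iff]
  intro t
  obtain ⟨s, r, rfl⟩ : ∃ (s : EuclideanSpace ℝ (Fin d)) (r : ℝ), t = WithLp.toLp 2 (s, r) :=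
    ⟨t.fst, t.snd, rfl⟩
  rw [Measure.map_map (by fun_prop) measurable_whitenedPair, charFun_apply,
    integral_map ((by fun_prop : Measurable (WithLp.toLp 2)).comp
      measurable_whitenedPair).aemeasurable (by fun_prop)]
  simp only [Function.comp_apply, WithLp.prod_inner_apply]
  simp_rw [inner_whitenedPair, Complex.ofReal_add, add_mul, Complex.exp_add]
  set q := T⁻¹.mulVec s.ofLp with hq
  rw [integral_prod_mul
    (fun x : EuclideanSpace ℝ (Fin d) =>
      Complex.exp (⟪x, WithLp.toLp 2 (q + r • (a - w₀))⟫ * Complex.I))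
    (fun z : EuclideanSpace ℝ (Fin d) =>
      Complex.exp (⟪z, WithLp.toLp 2 (q - r • w₀)⟫ * Complex.I)),
    ← charFun_apply, ← charFun_apply, charFun_multivariateGaussian hSig,
    charFun_multivariateGaussian hSigz, charFun_stdGaussian, charFun_gaussianReal,
    ← Complex.exp_add, ← Complex.exp_add]
  have hqq : q ⬝ᵥ (Sig + Sigz).mulVec q = ‖s‖ ^ 2 := by
    rw [← hT, ← Matrix.mulVec_mulVec, Matrix.dotProduct_mulVec, Matrix.vecMul_transpose, hq,
      Matrix.mulVec_mulVec, Matrix.mul_nonsing_inv _ hTu, Matrix.one_mulVec,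
      EuclideanSpace.real_norm_sq_eq]
    simp [dotProduct, sq]
  have h1 := quadratic_add hSig.isHermitian (r • (a - w₀)) q
  have h2 := quadratic_add hSigz.isHermitian (-(r • w₀)) q
  rw [add_comm] at h1
  rw [neg_add_eq_sub] at h2
  have hc : q ⬝ᵥ Sig.mulVec (a - w₀) - q ⬝ᵥ Sigz.mulVec w₀ = 0 := by
    rw [Matrix.mulVec_sub, ← h₀, ← dotProduct_sub, Matrix.add_mulVec]
    simp
  have hkey : (q + r • (a - w₀)) ⬝ᵥ Sig.mulVec (q + r • (a - w₀))
      + (q - r • w₀) ⬝ᵥ Sigz.mulVec (q - r • w₀)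
      = ‖s‖ ^ 2 + predictionError Sig Sigz a w₀ * r ^ 2 := by
    rw [h1, h2, ← hqq, predictionError, ← neg_sub a w₀, Matrix.add_mulVec, dotProduct_add]
    simp only [Matrix.mulVec_smul, Matrix.mulVec_neg, smul_dotProduct, dotProduct_smul,
      neg_dotProduct, dotProduct_neg, smul_eq_mul]
    linear_combination 2 * r * hc
  have hkey' := congrArg (fun x : ℝ => (x : ℂ)) hkey
  push_cast at hkey'
  congr 1
  rw [Real.coe_toNNReal _ (predictionError_nonneg hSig hSigz _ _)]
  simp only [inner_zero_right]
  push_cast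
  linear_combination (-1 / 2 : ℂ) * hkey'

/-- Scaled standard Gaussian vectors have independent Gaussian coordinates. -/
lemma map_toLp_pi_gaussianReal {c : ℝ} (hc : 0 ≤ c) :
    (Measure.pi fun _ : Fin n => gaussianReal 0 c.toNNReal).map (WithLp.toLp 2)
      = (stdGaussian (EuclideanSpace ℝ (Fin n))).map (fun x => √c • x) := by
  have h := gaussianReal_map_const_mul (μ := 0) (v := 1) (√c)
  have e : NNReal.mk (√c ^ 2) (sq_nonneg _) * 1 = c.toNNReal := by
    ext
    simp [Real.sq_sqrt hc, hc]
  rw [e, mul_zero] at h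
  have h1 := Measure.pi_map_pi (ι := Fin n) (μ := fun _ => gaussianReal 0 1)
    (f := fun _ x => √c * x) (fun _ => by fun_prop)
  simp_rw [h] at h1
  rw [← h1, ← map_pi_eq_stdGaussian, Measure.map_map (by fun_prop) (by fun_prop),
    Measure.map_map (by fun_prop) (by fun_prop)]
  rfl

/-- The whitened training observations form a standard Gaussian design, and the residuals form an
independent Gaussian response. -/
lemma IsTrainingSample.hasLaw_whitenedPair {Ω : Type*} [MeasurableSpace Ω] {P : Measure Ω}
    {X Z : Fin n → Ω → EuclideanSpace ℝ (Fin d)}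
    (hXZ : IsTrainingSample P Sig Sigz X Z) (hSig : Sig.PosSemidef) (hSigz : Sigz.PosSemidef)
    (hT : T.transpose * T = Sig + Sigz) (hTu : IsUnit T.det)
    (h₀ : (Sig + Sigz).mulVec w₀ = Sig.mulVec a) :
    HasLaw (fun ω => ((fun i => (whitenedPair T a w₀ (X i ω, Z i ω)).1),
        (WithLp.toLp 2 fun i => (whitenedPair T a w₀ (X i ω, Z i ω)).2 :
          EuclideanSpace ℝ (Fin n))))
      ((Measure.pi fun _ : Fin n => stdGaussian (EuclideanSpace ℝ (Fin d))).prod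
        ((stdGaussian (EuclideanSpace ℝ (Fin n))).map
          (fun x => √(predictionError Sig Sigz a w₀) • x))) P := by
  have h1 : HasLaw (fun ω j => Sum.elim X Z j ω) (Measure.pi (Sum.elim
      (fun _ : Fin n => multivariateGaussian (0 : EuclideanSpace ℝ (Fin d)) Sig)
      (fun _ : Fin n => multivariateGaussian (0 : EuclideanSpace ℝ (Fin d)) Sigz))) P := by
    refine iIndepFun.hasLaw_pi (fun j => ?_) hXZ.indep
    rcases j with i | i
    · exact hXZ.law_data i
    · exact hXZ.law_noise i
  have (j : Fin n ⊕ Fin n) : IsProbabilityMeasure (Sum.elim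
      (fun _ : Fin n => multivariateGaussian (0 : EuclideanSpace ℝ (Fin d)) Sig)
      (fun _ : Fin n => multivariateGaussian (0 : EuclideanSpace ℝ (Fin d)) Sigz) j) := by
    rcases j with i | i <;> simp only [Sum.elim_inl, Sum.elim_inr] <;> infer_instance
  have h2 := (measurePreserving_sumPiEquivProdPi (X := fun _ : Fin n ⊕ Fin n =>
    EuclideanSpace ℝ (Fin d)) (Sum.elim
      (fun _ : Fin n => multivariateGaussian (0 : EuclideanSpace ℝ (Fin d)) Sig)
      (fun _ : Fin n => multivariateGaussian (0 : EuclideanSpace ℝ (Fin d)) Sigz))).comp_hasLaw h1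
  have h3 := (measurePreserving_arrowProdEquivProdArrow (EuclideanSpace ℝ (Fin d))
    (EuclideanSpace ℝ (Fin d)) (Fin n)
    (fun _ => multivariateGaussian (0 : EuclideanSpace ℝ (Fin d)) Sig)
    (fun _ => multivariateGaussian (0 : EuclideanSpace ℝ (Fin d)) Sigz)).symm.comp_hasLaw h2
  have h4 : MeasurePreserving
      (fun (p : Fin n → EuclideanSpace ℝ (Fin d) × EuclideanSpace ℝ (Fin d)) i =>
        whitenedPair T a w₀ (p i))
      (Measure.pi fun _ => (multivariateGaussian 0 Sig).prod (multivariateGaussian 0 Sigz))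
      (Measure.pi fun _ => (stdGaussian (EuclideanSpace ℝ (Fin d))).prod
        (gaussianReal 0 (predictionError Sig Sigz a w₀).toNNReal)) :=
    measurePreserving_pi _ _ fun _ =>
      ⟨measurable_whitenedPair, map_whitenedPair hSig hSigz hT hTu h₀⟩
  have h5 := (measurePreserving_arrowProdEquivProdArrow (EuclideanSpace ℝ (Fin d)) ℝ (Fin n)
    (fun _ => stdGaussian (EuclideanSpace ℝ (Fin d)))
    (fun _ => gaussianReal 0 (predictionError Sig Sigz a w₀).toNNReal))
  have h6 : MeasurePreserving (WithLp.toLp 2)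
      (Measure.pi fun _ : Fin n => gaussianReal 0 (predictionError Sig Sigz a w₀).toNNReal)
      ((stdGaussian (EuclideanSpace ℝ (Fin n))).map
          (fun x => √(predictionError Sig Sigz a w₀) • x)) :=
    ⟨by fun_prop, map_toLp_pi_gaussianReal (predictionError_nonneg hSig hSigz _ _)⟩
  have h7 := (MeasurePreserving.id (Measure.pi fun _ : Fin n =>
    stdGaussian (EuclideanSpace ℝ (Fin d)))).prod h6
  exact h7.comp_hasLaw (h5.comp_hasLaw (h4.comp_hasLaw h3))

/-- The excess error of a least squares column is the squared norm of the ordinary least squares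
coefficients of the residuals on the whitened design. -/
lemma excess_eq_norm_sq_olsCoeff {X Z : Fin n → EuclideanSpace ℝ (Fin d)}
    {W : Matrix (Fin d) (Fin d) ℝ}
    (hW : IsLeastSquares (rowMatrix fun i => X i + Z i) (rowMatrix X) W)
    (hT : T.transpose * T = Sig + Sigz) (hTu : IsUnit T.det) (k : Fin d)
    (hspan : Submodule.span ℝ
      (Set.range fun i => (whitenedPair T (Pi.single k 1) w₀ (X i, Z i)).1) = ⊤) :
    (W.col k - w₀) ⬝ᵥ (Sig + Sigz).mulVec (W.col k - w₀)
      = ‖olsCoeff (fun i => (whitenedPair T (Pi.single k 1) w₀ (X i, Z i)).1)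
          (WithLp.toLp 2 fun i => (whitenedPair T (Pi.single k 1) w₀ (X i, Z i)).2)‖ ^ 2 := by
  set g : Fin n → EuclideanSpace ℝ (Fin d) :=
    fun i => (whitenedPair T (Pi.single k 1) w₀ (X i, Z i)).1 with hg
  set r : Fin n → ℝ := fun i => (whitenedPair T (Pi.single k 1) w₀ (X i, Z i)).2 with hr
  set Y := rowMatrix fun i => X i + Z i with hY
  have hYG : Y = rowMatrix g * T := by
    have : rowMatrix g = Y * T⁻¹ := by
      ext i j
      simp [hg, hY, rowMatrix, whitenedPair, Matrix.mul_apply, Matrix.mulVec, dotProduct, mul_comm]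
    rw [this, Matrix.mul_assoc, Matrix.nonsing_inv_mul _ hTu, Matrix.mul_one]
  have hrr : r = (rowMatrix X).col k - Y.mulVec w₀ := by
    ext i
    simp [hr, hY, rowMatrix, whitenedPair, Matrix.mulVec, dotProduct_comm w₀, Matrix.col]
    exact (add_dotProduct _ _ _).symm
  have hne : Y.transpose.mulVec (Y.mulVec (W.col k - w₀)) = Y.transpose.mulVec r := by
    have h : Y.transpose.mulVec (Y.mulVec (W.col k) - (rowMatrix X).col k) = 0 := by
      ext i
      have := congrFun (congrFun hW.normal_eq i) k
      simpa [Matrix.mul_apply, Matrix.mulVec, dotProduct, Matrix.col] using this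
    rw [← sub_eq_zero, ← Matrix.mulVec_sub, hrr, Matrix.mulVec_sub Y,
      sub_sub_sub_cancel_right, h]
  have hG : ((rowMatrix g).transpose * rowMatrix g).mulVec (T.mulVec (W.col k - w₀))
      = (rowMatrix g).transpose.mulVec r := by
    rw [hYG, Matrix.transpose_mul, ← Matrix.mulVec_mulVec, ← Matrix.mulVec_mulVec,
      ← Matrix.mulVec_mulVec] at hne
    have h := congrArg (T⁻¹.transpose).mulVec hne
    have hTT : T⁻¹.transpose * T.transpose = 1 := by
      rw [← Matrix.transpose_mul, Matrix.mul_nonsing_inv _ hTu, Matrix.transpose_one]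
    rw [Matrix.mulVec_mulVec, Matrix.mulVec_mulVec _ _ T.transpose, hTT, Matrix.one_mulVec,
      Matrix.one_mulVec] at h
    rw [← h, ← Matrix.mulVec_mulVec, Matrix.mulVec_mulVec]
  have hT' : T.mulVec (W.col k - w₀)
      = (olsCoeff g (WithLp.toLp 2 r)).ofLp := by
    rw [olsCoeff, ← hG, Matrix.mulVec_mulVec,
      Matrix.nonsing_inv_mul _ (isUnit_gram_of_span_eq_top hspan), Matrix.one_mulVec]
  rw [EuclideanSpace.real_norm_sq_eq, ← hT', ← hT, ← Matrix.mulVec_mulVec,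
    Matrix.dotProduct_mulVec, Matrix.vecMul_transpose]
  simp [dotProduct, sq]

end Whitening

/-! ### Concentration of the least squares error -/

section Excess

open scoped MatrixOrder in
lemma exists_transpose_mul_self_eq {d : ℕ} {S : Matrix (Fin d) (Fin d) ℝ} (hS : S.PosDef) :
    ∃ T : Matrix (Fin d) (Fin d) ℝ, T.transpose * T = S ∧ IsUnit T.det := by
  have h1 : CFC.sqrt S * CFC.sqrt S = S := CFC.sqrt_mul_sqrt_self S hS.posSemidef.nonneg
  have h2 : (CFC.sqrt S).transpose = CFC.sqrt S := by
    have : star (CFC.sqrt S) = CFC.sqrt S := (CFC.sqrt_nonneg S).isSelfAdjoint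
    rwa [Matrix.star_eq_conjTranspose, Matrix.conjTranspose_eq_transpose_of_trivial] at this
  refine ⟨CFC.sqrt S, by rw [h2, h1], isUnit_iff_ne_zero.2 fun h => ?_⟩
  have := hS.det_pos
  rw [← h1, Matrix.det_mul, h, mul_zero] at this
  exact lt_irrefl _ this

lemma olsCoeff_smul {n d : ℕ} (g : Fin n → EuclideanSpace ℝ (Fin d)) (a : ℝ)
    (r : EuclideanSpace ℝ (Fin n)) : olsCoeff g (a • r) = a • olsCoeff g r := by
  ext i
  simp [olsCoeff, Matrix.mulVec_smul]

/-- The mean absolute deviation of `‖(Gᵀ G)⁻¹ Gᵀ r‖²` for a response `r` of variance `c`. -/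
lemma integral_abs_norm_sq_olsCoeff_sub_le_of_hasLaw {n d : ℕ} (hnd : d + 3 < n) {c : ℝ}
    (hc : 0 ≤ c) {Ω : Type*} [MeasurableSpace Ω] {P : Measure Ω}
    {V : Ω → (Fin n → EuclideanSpace ℝ (Fin d)) × EuclideanSpace ℝ (Fin n)}
    (hV : HasLaw V ((Measure.pi fun _ : Fin n => stdGaussian (EuclideanSpace ℝ (Fin d))).prod
      ((stdGaussian (EuclideanSpace ℝ (Fin n))).map (fun x => √c • x))) P) :
    Integrable (fun ω => ‖olsCoeff (V ω).1 (V ω).2‖ ^ 2 - c * (d / ((n : ℝ) - d - 1))) P ∧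
    ∫ ω, |‖olsCoeff (V ω).1 (V ω).2‖ ^ 2 - c * (d / ((n : ℝ) - d - 1))| ∂P
      ≤ c * √(olsVariance n d) := by
  obtain ⟨hi, hle⟩ := integral_abs_norm_sq_olsCoeff_sub_le hnd
  set μ : ℝ := d / ((n : ℝ) - d - 1)
  have hmp : MeasurePreserving
      (Prod.map id fun x => √c • x : (Fin n → EuclideanSpace ℝ (Fin d)) × EuclideanSpace ℝ (Fin n) →
        (Fin n → EuclideanSpace ℝ (Fin d)) × EuclideanSpace ℝ (Fin n)) (designLaw n d)
      ((Measure.pi fun _ : Fin n => stdGaussian (EuclideanSpace ℝ (Fin d))).prod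
      ((stdGaussian (EuclideanSpace ℝ (Fin n))).map (fun x => √c • x))) :=
    (MeasurePreserving.id _).prod ⟨by fun_prop, rfl⟩
  have hm : Measurable fun p : (Fin n → EuclideanSpace ℝ (Fin d)) × EuclideanSpace ℝ (Fin n) =>
      ‖olsCoeff p.1 p.2‖ ^ 2 - c * μ := (measurable_olsCoeff.norm.pow_const 2).sub_const _
  have e : ∀ p : (Fin n → EuclideanSpace ℝ (Fin d)) × EuclideanSpace ℝ (Fin n),
      ‖olsCoeff p.1 (√c • p.2)‖ ^ 2 - c * μ = c * (‖olsCoeff p.1 p.2‖ ^ 2 - μ) := by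
    intro p
    rw [olsCoeff_smul, norm_smul, mul_pow, Real.norm_eq_abs, sq_abs, Real.sq_sqrt hc]
    ring
  constructor
  · have h1 : Integrable (fun p : (Fin n → EuclideanSpace ℝ (Fin d)) × EuclideanSpace ℝ (Fin n) =>
        ‖olsCoeff p.1 p.2‖ ^ 2 - c * μ) (P.map V) := by
      rw [hV.map_eq, ← hmp.integrable_comp hm.aestronglyMeasurable]
      refine ((integrable_norm_sq_olsCoeff (n := n) (d := d) (by omega)).sub
        (integrable_const μ)).const_mul c |>.congr (ae_of_all _ fun p => (e p).symm)
    exact h1.comp_aemeasurable hV.aemeasurable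
  · have h2 := hV.integral_comp (f := fun p => |‖olsCoeff p.1 p.2‖ ^ 2 - c * μ|)
      hm.abs.aestronglyMeasurable
    rw [← hmp.map_eq, integral_map hmp.measurable.aemeasurable hm.abs.aestronglyMeasurable] at h2
    simp only [Function.comp_def, Prod.map_fst, Prod.map_snd, id, e, abs_mul, abs_of_nonneg hc]
      at h2
    rw [h2, integral_const_mul]
    exact mul_le_mul_of_nonneg_left hle hc

variable {n d : ℕ} {Sig Sigz : Matrix (Fin d) (Fin d) ℝ} {Ω : Type*} [MeasurableSpace Ω]
  {P : Measure Ω} {X Z : Fin n → Ω → EuclideanSpace ℝ (Fin d)}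
  {W : Ω → Matrix (Fin d) (Fin d) ℝ}

/-- The error of the least squares denoiser is within `√(olsVariance n d)` Wiener errors of
`1 + d / (n - d - 1)` Wiener errors, on average. -/
lemma IsTrainingSample.exists_genError_ae_eq (hXZ : IsTrainingSample P Sig Sigz X Z)
    (hSig : Sig.PosDef) (hSigz : Sigz.PosSemidef) (hnd : d + 3 < n)
    (hW : ∀ᵐ ω ∂P, IsLeastSquares (rowMatrix fun i => X i ω + Z i ω)
      (rowMatrix fun i => X i ω) (W ω)) :
    ∃ F : Ω → ℝ,
      (∀ᵐ ω ∂P, genError Sig Sigz (W ω)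
        - (1 + d / ((n : ℝ) - d - 1)) * wienerError Sig Sigz = F ω) ∧
      Integrable F P ∧ ∫ ω, |F ω| ∂P ≤ wienerError Sig Sigz * √(olsVariance n d) := by
  obtain ⟨T, hT, hTu⟩ := exists_transpose_mul_self_eq (hSig.add_posSemidef hSigz)
  set w₀ : Fin d → Fin d → ℝ := fun k => (wienerFilter Sig Sigz).col k with hw₀
  have hlaw := fun k => hXZ.hasLaw_whitenedPair hSig.posSemidef hSigz hT hTu
    (wienerFilter_col hSig hSigz k)
  have hdev := fun k => integral_abs_norm_sq_olsCoeff_sub_le_of_hasLaw hnd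
    (predictionError_nonneg hSig.posSemidef hSigz _ _) (hlaw k)
  have hspan : ∀ᵐ ω ∂P, ∀ k, Submodule.span ℝ (Set.range fun i =>
      (whitenedPair T (Pi.single k 1) (w₀ k) (X i ω, Z i ω)).1) = ⊤ := by
    rw [ae_all_iff]
    intro k
    have h := (Measure.quasiMeasurePreserving_fst (ν := (stdGaussian
      (EuclideanSpace ℝ (Fin n))).map
        (fun x => √(predictionError Sig Sigz (Pi.single k 1) (w₀ k)) • x))).ae
      (ae_span_eq_top_pi_stdGaussian (E := EuclideanSpace ℝ (Fin d)) (n := n)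
        (by rw [finrank_euclideanSpace_fin]; omega))
    rw [← (hlaw k).map_eq] at h
    exact ae_of_ae_map (hlaw k).aemeasurable h
  refine ⟨fun ω => ∑ k, (‖olsCoeff
    (fun i => (whitenedPair T (Pi.single k 1) (w₀ k) (X i ω, Z i ω)).1)
    (WithLp.toLp 2 fun i => (whitenedPair T (Pi.single k 1) (w₀ k) (X i ω, Z i ω)).2)‖ ^ 2
    - predictionError Sig Sigz (Pi.single k 1) (w₀ k) * (d / ((n : ℝ) - d - 1))), ?_,
    integrable_finsetSum _ fun k _ => (hdev k).1, ?_⟩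
  · filter_upwards [hW, hspan] with ω hω hs
    rw [genError_eq_add hSig hSigz, genError_wienerFilter hSig hSigz, Finset.sum_sub_distrib,
      ← Finset.sum_mul, ← wienerError_eq_sum hSig hSigz,
      Finset.sum_congr rfl fun k _ => excess_eq_norm_sq_olsCoeff hω hT hTu k (hs k)]
    ring
  · calc _ ≤ ∫ ω, ∑ k, |‖olsCoeff
          (fun i => (whitenedPair T (Pi.single k 1) (w₀ k) (X i ω, Z i ω)).1)
          (WithLp.toLp 2 fun i => (whitenedPair T (Pi.single k 1) (w₀ k) (X i ω, Z i ω)).2)‖ ^ 2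
          - predictionError Sig Sigz (Pi.single k 1) (w₀ k) * (d / ((n : ℝ) - d - 1))| ∂P :=
        integral_mono (integrable_finsetSum _ fun k _ => (hdev k).1).abs
          (integrable_finsetSum _ fun k _ => (hdev k).1.abs)
          fun ω => Finset.abs_sum_le_sum_abs _ _
      _ = _ := integral_finsetSum _ fun k _ => (hdev k).1.abs
      _ ≤ _ := by
        rw [wienerError_eq_sum hSig hSigz, Finset.sum_mul]
        exact Finset.sum_le_sum fun k _ => (hdev k).2

/-- Markov's inequality for the deviation of the least squares error, relative to the Wiener
error. The bound does not depend on the covariances. -/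
lemma IsTrainingSample.measure_lt_abs_le (hXZ : IsTrainingSample P Sig Sigz X Z)
    (hSig : Sig.PosDef) (hSigz : Sigz.PosSemidef) (hnd : d + 3 < n)
    (hW : ∀ᵐ ω ∂P, IsLeastSquares (rowMatrix fun i => X i ω + Z i ω)
      (rowMatrix fun i => X i ω) (W ω)) {δ : ℝ} (hδ : 0 < δ) :
    P {ω | δ * wienerError Sig Sigz < |genError Sig Sigz (W ω)
        - (1 + d / ((n : ℝ) - d - 1)) * wienerError Sig Sigz|}
      ≤ ENNReal.ofReal (√(olsVariance n d) / δ) := by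
  have := hXZ.indep.isProbabilityMeasure
  obtain ⟨F, hF, hFi, hle⟩ := hXZ.exists_genError_ae_eq hSig hSigz hnd hW
  have h1 : P {ω | δ * wienerError Sig Sigz < |genError Sig Sigz (W ω)
        - (1 + d / ((n : ℝ) - d - 1)) * wienerError Sig Sigz|}
      = P {ω | δ * wienerError Sig Sigz < |F ω|} := by
    refine measure_congr ?_
    filter_upwards [hF] with ω hω
    change (_ < |genError Sig Sigz (W ω) - _|) = (_ < _)
    rw [hω]
  rw [h1]
  rcases (wienerError_nonneg hSig hSigz).eq_or_lt with h0 | h0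
  · -- a vanishing Wiener error makes the mean absolute deviation vanish
    rw [← h0, zero_mul] at hle
    have h2 : ∫ ω, |F ω| ∂P = 0 := le_antisymm hle (integral_nonneg fun _ => abs_nonneg _)
    rw [integral_eq_zero_iff_of_nonneg (fun _ => abs_nonneg _) hFi.abs] at h2
    have h3 : P {ω | δ * wienerError Sig Sigz < |F ω|} = 0 := by
      rw [measure_eq_zero_iff_ae_notMem]
      filter_upwards [h2] with ω hω
      have : |F ω| = 0 := hω
      simp [this, ← h0]
    rw [h3]
    exact zero_le
  · have hpos : 0 < δ * wienerError Sig Sigz := mul_pos hδ h0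
    have h2 := mul_meas_ge_le_integral_of_nonneg (ae_of_all _ fun ω => abs_nonneg (F ω)) hFi.abs
      (δ * wienerError Sig Sigz)
    have h3 : P.real {ω | δ * wienerError Sig Sigz ≤ |F ω|} ≤ √(olsVariance n d) / δ := by
      rw [le_div_iff₀ hδ]
      refine le_of_mul_le_mul_left ?_ h0
      linarith
    calc P {ω | δ * wienerError Sig Sigz < |F ω|}
        ≤ P {ω | δ * wienerError Sig Sigz ≤ |F ω|} := by
          refine measure_mono fun ω hω => ?_
          rw [Set.mem_ofPred_eq] at hω ⊢
          exact hω.le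
      _ = ENNReal.ofReal (P.real {ω | δ * wienerError Sig Sigz ≤ |F ω|}) := by
          rw [ofReal_measureReal]
      _ ≤ _ := ENNReal.ofReal_le_ofReal h3

end Excess

/-! ### Proportional asymptotics -/

section Asymptotics

variable {κ : ℝ} {n d : ℕ → ℕ}

lemma tendsto_sub_div (hd : Tendsto d atTop atTop)
    (hnd : Tendsto (fun m => (n m : ℝ) / (d m : ℝ)) atTop (𝓝 κ)) (c : ℝ) :
    Tendsto (fun m => ((n m : ℝ) - d m - c) / d m) atTop (𝓝 (κ - 1)) := by
  have hd' : Tendsto (fun m => (d m : ℝ)) atTop atTop := tendsto_natCast_atTop_atTop.comp hd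
  have h := (hnd.sub_const 1).sub (hd'.const_div_atTop c)
  rw [sub_zero] at h
  refine h.congr' ?_
  filter_upwards [hd'.eventually_gt_atTop 0] with m hm
  field_simp

lemma eventually_add_three_lt (hκ : 1 < κ) (hd : Tendsto d atTop atTop)
    (hnd : Tendsto (fun m => (n m : ℝ) / (d m : ℝ)) atTop (𝓝 κ)) :
    ∀ᶠ m in atTop, d m + 3 < n m := by
  have hd' : Tendsto (fun m => (d m : ℝ)) atTop atTop := tendsto_natCast_atTop_atTop.comp hd
  filter_upwards [(tendsto_sub_div hd hnd 3).eventually_const_lt (sub_pos.2 hκ),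
    hd'.eventually_gt_atTop 0] with m h hm
  have := (div_pos_iff_of_pos_right hm).1 h
  have : (d m : ℝ) + 3 < n m := by linarith
  exact_mod_cast this

lemma tendsto_div_sub_one (hκ : 1 < κ) (hd : Tendsto d atTop atTop)
    (hnd : Tendsto (fun m => (n m : ℝ) / (d m : ℝ)) atTop (𝓝 κ)) :
    Tendsto (fun m => (d m : ℝ) / ((n m : ℝ) - d m - 1)) atTop (𝓝 (1 / (κ - 1))) := by
  have h := (tendsto_sub_div hd hnd 1).inv₀ (sub_pos.2 hκ).ne'
  simpa [inv_div] using h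

lemma tendsto_olsVariance (hκ : 1 < κ) (hd : Tendsto d atTop atTop)
    (hnd : Tendsto (fun m => (n m : ℝ) / (d m : ℝ)) atTop (𝓝 κ)) :
    Tendsto (fun m => olsVariance (n m) (d m)) atTop (𝓝 0) := by
  have hd' : Tendsto (fun m => (d m : ℝ)) atTop atTop := tendsto_natCast_atTop_atTop.comp hd
  have h1 := tendsto_div_sub_one hκ hd hnd
  have h3 := (tendsto_sub_div hd hnd 3).inv₀ (sub_pos.2 hκ).ne'
  have h2 : Tendsto (fun m => 1 + 2 / (d m : ℝ)) atTop (𝓝 1) := by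
    simpa using (hd'.const_div_atTop 2).const_add 1
  have h := ((h1.mul h3).mul h2).sub (h1.pow 2)
  rw [show 1 / (κ - 1) * (κ - 1)⁻¹ * 1 - (1 / (κ - 1)) ^ 2 = 0 by ring] at h
  refine h.congr' ?_
  filter_upwards [eventually_add_three_lt hκ hd hnd, hd'.eventually_gt_atTop 0] with m hm hm0
  have hm' : (d m : ℝ) + 3 < n m := by exact_mod_cast hm
  have e1 : (n m : ℝ) - d m - 1 ≠ 0 := by linarith
  have e3 : (n m : ℝ) - d m - 3 ≠ 0 := by linarith
  rw [olsVariance, inv_div]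
  field_simp

/-- The least squares error is asymptotically `κ / (κ - 1)` times the Wiener error. -/
lemma asymptoticallyEqual_genError {κ : ℝ} (hκ : 1 < κ) {n d : ℕ → ℕ}
    (hd : Tendsto d atTop atTop)
    (hnd : Tendsto (fun m => (n m : ℝ) / (d m : ℝ)) atTop (𝓝 κ))
    {Sig Sigz : ∀ m, Matrix (Fin (d m)) (Fin (d m)) ℝ}
    (hSig : ∀ m, (Sig m).PosDef) (hSigz : ∀ m, (Sigz m).PosSemidef)
    {Ω : ℕ → Type*} [∀ m, MeasurableSpace (Ω m)] {P : ∀ m, Measure (Ω m)}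
    {X Z : ∀ m, Fin (n m) → Ω m → EuclideanSpace ℝ (Fin (d m))}
    (hXZ : ∀ m, IsTrainingSample (P m) (Sig m) (Sigz m) (X m) (Z m))
    {W : ∀ m, Ω m → Matrix (Fin (d m)) (Fin (d m)) ℝ}
    (hW : ∀ m, ∀ᵐ ω ∂(P m), IsLeastSquares (rowMatrix fun i => X m i ω + Z m i ω)
      (rowMatrix fun i => X m i ω) (W m ω)) :
    AsymptoticallyEqual P (fun m ω => genError (Sig m) (Sigz m) (W m ω))
      (fun m => κ / (κ - 1) * wienerError (Sig m) (Sigz m)) := by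
  intro ε hε
  have hκ' : 0 < κ - 1 := sub_pos.2 hκ
  have hc : 0 < κ / (κ - 1) := div_pos (by linarith) hκ'
  set δ := ε * (κ / (κ - 1)) / 2 with hδ
  have hδ0 : 0 < δ := by positivity
  have hlim : Tendsto (fun m => ENNReal.ofReal (√(olsVariance (n m) (d m)) / δ)) atTop (𝓝 0) := by
    have h := (tendsto_olsVariance hκ hd hnd).sqrt.div_const δ
    simpa using ENNReal.tendsto_ofReal h
  -- the mean `1 + d / (n - d - 1)` is replaced by its limit at the cost of half of `ε`
  have hμ : ∀ᶠ m in atTop,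
      |(d m : ℝ) / ((n m : ℝ) - d m - 1) - 1 / (κ - 1)| < δ := by
    simpa [Real.dist_eq] using (tendsto_div_sub_one hκ hd hnd).eventually
      (Metric.ball_mem_nhds _ hδ0)
  refine tendsto_of_tendsto_of_tendsto_of_le_of_le' tendsto_const_nhds hlim
    (Eventually.of_forall fun _ => zero_le) ?_
  filter_upwards [hμ, eventually_add_three_lt hκ hd hnd] with m hm hm3
  refine le_trans (measure_mono fun ω hω => ?_)
    ((hXZ m).measure_lt_abs_le (hSig m) (hSigz m) hm3 (hW m) hδ0)
  have hτ := wienerError_nonneg (hSig m) (hSigz m)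
  rw [Set.mem_ofPred_eq] at hω ⊢
  set τ := wienerError (Sig m) (Sigz m)
  set μ := (d m : ℝ) / ((n m : ℝ) - d m - 1)
  set G := genError (Sig m) (Sigz m) (W m ω)
  rw [abs_of_nonneg (mul_nonneg hc.le hτ)] at hω
  have h1 : |G - κ / (κ - 1) * τ| ≤ |G - (1 + μ) * τ| + |(μ - 1 / (κ - 1)) * τ| := by
    refine le_trans (le_of_eq ?_) (abs_add_le _ _)
    congr 1
    field_simp
    ring
  have h2 : |(μ - 1 / (κ - 1)) * τ| ≤ δ * τ := by
    rw [abs_mul, abs_of_nonneg hτ]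
    exact mul_le_mul_of_nonneg_right hm.le hτ
  have h3 : ε * (κ / (κ - 1) * τ) = δ * τ + δ * τ := by rw [hδ]; ring
  linarith

end Asymptotics

end LinearDenoising

theorem corollary1
    (κ : ℝ) (hκ : 1 < κ) (n d : ℕ → ℕ)
    (hd : Tendsto d atTop atTop)
    (hnd : Tendsto (fun m => (n m : ℝ) / (d m : ℝ)) atTop (𝓝 κ))
    (Sig Sigz : ∀ m, Matrix (Fin (d m)) (Fin (d m)) ℝ)
    (hSig : ∀ m, (Sig m).PosDef) (hSigz : ∀ m, (Sigz m).PosSemidef)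
    (hcomm : ∀ m, Commute (Sig m) (Sigz m))
    {Ω : ℕ → Type*} [∀ m, MeasurableSpace (Ω m)]
    (P : ∀ m, Measure (Ω m)) [∀ m, IsProbabilityMeasure (P m)]
    (X Z : ∀ m, Fin (n m) → Ω m → EuclideanSpace ℝ (Fin (d m)))
    (hXZ : ∀ m, LinearDenoising.IsTrainingSample (P m) (Sig m) (Sigz m) (X m) (Z m))
    (W : ∀ m, Ω m → Matrix (Fin (d m)) (Fin (d m)) ℝ)
    (hW : ∀ m, ∀ᵐ ω ∂(P m), LinearDenoising.IsLeastSquares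
      (LinearDenoising.rowMatrix (fun i => X m i ω + Z m i ω))
      (LinearDenoising.rowMatrix (fun i => X m i ω)) (W m ω)) :
    -- the minimum over all linear denoisers is attained by the Wiener filter
    (∀ m,
      LinearDenoising.genError (Sig m) (Sigz m)
          (LinearDenoising.wienerFilter (Sig m) (Sigz m))
        = LinearDenoising.wienerError (Sig m) (Sigz m) ∧
      ∀ W' : Matrix (Fin (d m)) (Fin (d m)) ℝ,
        LinearDenoising.wienerError (Sig m) (Sigz m)
          ≤ LinearDenoising.genError (Sig m) (Sigz m) W') ∧
    -- asymptotic equality of the error with `κ / (κ - 1)` times the Wiener error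
    LinearDenoising.AsymptoticallyEqual P
      (fun m ω => LinearDenoising.genError (Sig m) (Sigz m) (W m ω))
      (fun m => κ / (κ - 1) * LinearDenoising.wienerError (Sig m) (Sigz m)) ∧
    -- the same as a ratio, which is defined as soon as there is some noise
    ((∀ᶠ m in atTop, Sigz m ≠ 0) →
      ∀ ε : ℝ, 0 < ε → Tendsto (fun m => P m {ω | ε <
        |LinearDenoising.genError (Sig m) (Sigz m) (W m ω) /
          (κ / (κ - 1) * LinearDenoising.wienerError (Sig m) (Sigz m)) - 1|}) atTop (𝓝 0)) ∧
    -- recovery of the Wiener error for large `κ`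
    Tendsto (fun k : ℝ => k / (k - 1)) atTop (𝓝 1) ∧
    (∀ ε : ℝ, 0 < ε → 1 + 1 / ε < κ → Tendsto (fun m => P m {ω |
      ε * LinearDenoising.wienerError (Sig m) (Sigz m) <
        |LinearDenoising.genError (Sig m) (Sigz m) (W m ω)
          - LinearDenoising.wienerError (Sig m) (Sigz m)|}) atTop (𝓝 0)) ∧
    -- the error never falls below the Wiener error
    (∀ m ω, LinearDenoising.wienerError (Sig m) (Sigz m)
      ≤ LinearDenoising.genError (Sig m) (Sigz m) (W m ω)) := by
  have hκ' : 0 < κ - 1 := sub_pos.2 hκ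
  have hc : 0 < κ / (κ - 1) := div_pos (by linarith) hκ'
  have hτ := fun m => LinearDenoising.wienerError_nonneg (hSig m) (hSigz m)
  have hle : ∀ m W', LinearDenoising.wienerError (Sig m) (Sigz m)
      ≤ LinearDenoising.genError (Sig m) (Sigz m) W' := fun m W' => by
    rw [← LinearDenoising.genError_wienerFilter (hSig m) (hSigz m)]
    exact LinearDenoising.genError_wienerFilter_le (hSig m) (hSigz m) W'
  have hasymp := LinearDenoising.asymptoticallyEqual_genError hκ hd hnd hSig hSigz hXZ hW
  refine ⟨fun m => ⟨LinearDenoising.genError_wienerFilter (hSig m) (hSigz m), hle m⟩, hasymp,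
    fun hne ε hε => ?_, ?_, fun ε hε hεκ => ?_, fun m ω => hle m _⟩
  · refine (hasymp ε hε).congr' ?_
    filter_upwards [hne] with m hm
    have hpos : 0 < κ / (κ - 1) * LinearDenoising.wienerError (Sig m) (Sigz m) :=
      mul_pos hc (LinearDenoising.wienerError_pos (hSig m) (hSigz m) hm)
    congr 1
    ext ω
    simp only [Set.mem_ofPred_eq]
    rw [div_sub_one hpos.ne', abs_div, lt_div_iff₀ (abs_pos.2 hpos.ne')]
  · have h : Tendsto (fun k : ℝ => 1 + 1 / (k - 1)) atTop (𝓝 (1 + 0)) := by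
      refine Tendsto.const_add 1 ?_
      simp only [one_div]
      exact tendsto_inv_atTop_zero.comp (tendsto_atTop_add_const_right _ _ tendsto_id)
    rw [add_zero] at h
    refine h.congr' ?_
    filter_upwards [eventually_gt_atTop (1 : ℝ)] with k hk
    have : k - 1 ≠ 0 := by linarith
    field_simp
    ring
  · -- the limit `κ / (κ - 1)` differs from `1` by `1 / (κ - 1) < ε`
    have hlt : 1 / (κ - 1) < ε := by
      rw [div_lt_iff₀ hκ', mul_comm, ← div_lt_iff₀ hε]
      linarith
    have hε' : 0 < (ε - 1 / (κ - 1)) / (κ / (κ - 1)) := div_pos (sub_pos.2 hlt) hc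
    refine tendsto_of_tendsto_of_tendsto_of_le_of_le tendsto_const_nhds (hasymp _ hε')
      (fun _ => zero_le) fun m => measure_mono fun ω hω => ?_
    rw [Set.mem_ofPred_eq] at hω ⊢
    have hτm := hτ m
    set τ := LinearDenoising.wienerError (Sig m) (Sigz m)
    set G := LinearDenoising.genError (Sig m) (Sigz m) (W m ω)
    rw [abs_of_nonneg (mul_nonneg hc.le hτm), ← mul_assoc, div_mul_cancel₀ _ hc.ne']
    have h1 : |G - τ| ≤ |G - κ / (κ - 1) * τ| + |1 / (κ - 1) * τ| := by
      refine le_trans (le_of_eq ?_) (abs_add_le _ _)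
      congr 1
      field_simp
      ring
    rw [abs_of_nonneg (mul_nonneg (one_div_nonneg.2 hκ'.le) hτm)] at h1
    linarith
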